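/- Let $T$ be a locally compact, separable, metrizable, $0$-dimensional space and let $\Gamma$ be a pseudogroup of homeomorphisms between open subsets of $T$, with orbit equivalence relation $\mathcal R=\{(y,\gamma(y)) : \gamma\in\Gamma,\ y\in\mathrm{dom}\,\gamma\}$. Assume that $\Gamma$ acts freely, i.e. an element of $\Gamma$ fixing a point coincides with the identity near this point, and endow $\mathcal R$ with the topology generated by the graphs of the elements of $\Gamma$. Assume that $\Gamma$ is compactly generated: there is a relatively compact open set $T_1\subset T$ meeting all the orbits, such that the reduction $\Gamma|_{T_1}$ (the elements with domain and range in $T_1$) has a finite generating set each element of which is the restriction of an element of $\Gamma$ whose domain contains the closure of its own domain. Let $\Gamma^{(1)}$ be a finite generating set of $\Gamma$. It defines a graph with vertex set $T$: write $z\sim w$ if $z\neq w$ and some element of $\Gamma^{(1)}$ sends $z$ to $w$ or $w$ to $z$, and let $\deg(z)$ be the number of neighbours of $z$. Assume that $\Gamma^{(1)}$ is recurrent, i.e. every point of $T$ is at uniformly bounded graph distance from $T_1$. Let $\delta:\mathcal R\to\mathbb R^*_+$ be a continuous harmonic cocycle, i.e. $\delta$ is continuous, $\delta(x,y)\delta(y,z)=\delta(x,z)$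 for $(x,y),(y,z)\in\mathcal R$, every point has at least one neighbour, and $\delta(z,y)=\frac1{\deg(z)}\sum_{w\sim z}\delta(w,y)$ for all $(z,y)\in\mathcal R$. For a finite subset $B$ of the orbit $\mathcal R[y]$ put $|B|_y=\sum_{z\in B}\delta(z,y)$. Let $\{A_n\}$ be a $\delta$-averaging sequence, i.e. a sequence of nonempty finite sets $A_n\subset\mathcal R[y_n]$ with $$\lim_{n\to\infty}\frac{|\Delta_\gamma A_n|_{y_n}}{|A_n|_{y_n}}=0\quad\text{for all }\gamma\in\Gamma^{(1)},$$ where $\Delta_\gamma A=\{x\in \mathrm{dom}\,\gamma : \text{exactly one of } x,\gamma(x) \text{ belongs to } A\}$. Its limit set is the set of all limits of sequences $u_k\in A_{n_k}$ with $n_1<n_2<\cdots$. Then there is a nonzero finite regular Borel measure $\nu$ on $T$ whose support is contained in the limit set of $\{A_n\}$ and which is harmonic: it is quasi-invariant under $\Gamma$, and for every bounded measurable $f:T\to\mathbb R$ the function $\Delta f(y)=\frac1{\deg(y)}\sum_{z\sim y}f(z)-f(y)$ is $\nu$-integrable with $\int\Delta f\,d\nu=0$. Moreover $\nu$ arises from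 $\{A_n\}$ as $\nu=\deg\cdot\nu_0$, where $\nu_0$ is a finite measure with Radon–Nikodym cocycle $\delta$, i.e. $\nu_0(\gamma(B))=\int_B\delta(\gamma(y),y)\,d\nu_0(y)$ for all $\gamma\in\Gamma$ and all Borel sets $B\subset\mathrm{dom}\,\gamma$, and $\nu_0$ is the vague limit of a subsequence of the probability measures $\nu_n(B)=|B\cap A_n|_{y_n}/|A_n|_{y_n}$. -/

import Mathlib

open MeasureTheory Filter
open scoped Topology

noncomputable section

namespace Averaging

variable {T : Type*} [TopologicalSpace T]

/-! ### Pseudogroups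

A pseudogroup of homeomorphisms between open subsets of `T` is a `StructureGroupoid T` which is
closed under restriction to open subsets. -/

/-- `S` generates `Γ`: `Γ` is the smallest pseudogroup containing `S`. -/
def Generates (Γ : StructureGroupoid T) (S : Set (OpenPartialHomeomorph T T)) : Prop :=
  (∀ γ ∈ S, γ ∈ Γ) ∧
    ∀ G : StructureGroupoid T, ClosedUnderRestriction G → (∀ γ ∈ S, γ ∈ G) → Γ ≤ G

/-- The orbit equivalence relation of `Γ`: the pairs `(y, γ y)` with `γ ∈ Γ` defined at `y`. -/
def orbitRel (Γ : StructureGroupoid T) : Set (T × T) :=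
  {p | ∃ γ ∈ Γ, p.1 ∈ γ.source ∧ γ p.1 = p.2}

/-- The topology of the orbit equivalence relation generated by the graphs of the elements
of `Γ`. -/
abbrev etaleTopology (Γ : StructureGroupoid T) : TopologicalSpace (orbitRel Γ) :=
  TopologicalSpace.generateFrom
    {U | ∃ γ ∈ Γ, U = {p : orbitRel Γ | p.1.1 ∈ γ.source ∧ γ p.1.1 = p.1.2}}

/-- `Γ` acts freely: an element of `Γ` fixing a point has the germ of the identity there. -/
def ActsFreely (Γ : StructureGroupoid T) : Prop :=
  ∀ γ ∈ Γ, ∀ x ∈ γ.source, γ x = x → ∀ᶠ z in 𝓝 x, γ z = z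

/-- The finite set `E` is a compact generation system of `Γ` on `T₁`: the set `T₁` is open,
relatively compact and meets every orbit, `E` generates the reduction of `Γ` to `T₁`, and every
element of `E` is the restriction of an element of `Γ` whose domain contains the closure of its
own domain. (An element with domain and range in `T₁` lies in the pseudogroup on `T₁` generated
by `E` if and only if it lies in the pseudogroup on `T` generated by `E`.) -/
structure IsCompactGenerationSystem (Γ : StructureGroupoid T) (T₁ : Set T)
    (E : Set (OpenPartialHomeomorph T T)) : Prop where
  isOpen : IsOpen T₁
  isCompact_closure : IsCompact (closure T₁)
  meets_orbits : ∀ y : T, ∃ z ∈ T₁, (y, z) ∈ orbitRel Γ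
  finite : E.Finite
  mem_reduction : ∀ γ ∈ E, γ ∈ Γ ∧ γ.source ⊆ T₁ ∧ γ.target ⊆ T₁
  generates : ∀ G : StructureGroupoid T, ClosedUnderRestriction G → (∀ γ ∈ E, γ ∈ G) →
    ∀ γ ∈ Γ, γ.source ⊆ T₁ → γ.target ⊆ T₁ → γ ∈ G
  extends_to_closure : ∀ γ ∈ E, ∃ γ' ∈ Γ, closure γ.source ⊆ γ'.source ∧ Set.EqOn γ γ' γ.source

/-- The graph whose vertices are the points of `T`, two distinct points `z`, `w` being joined by
an edge if an element of `S` sends one to the other. If `S` generates a pseudogroup, then its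
connected components are the orbits. -/
def orbitGraph (S : Set (OpenPartialHomeomorph T T)) : SimpleGraph T :=
  SimpleGraph.fromRel fun z w => ∃ γ ∈ S, z ∈ γ.source ∧ γ z = w

/-- The finite generating set `S` is recurrent with respect to `T₁`: every point of `T` is at
uniformly bounded graph distance from a point of `T₁` (in its orbit). -/
def IsRecurrent (S : Set (OpenPartialHomeomorph T T)) (T₁ : Set T) : Prop :=
  ∃ N : ℕ, ∀ y : T, ∃ z ∈ T₁, ∃ p : (orbitGraph S).Walk y z, p.length ≤ N

/-- The number of neighbours of `y`. -/
def deg (S : Set (OpenPartialHomeomorph T T)) (y : T) : ℕ :=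
  ((orbitGraph S).neighborSet y).ncard

/-- The Laplace operator of the simple random walk:
`Δ f (y) = (1 / deg y) ∑_{z ∼ y} f z - f y`. -/
def laplacian (S : Set (OpenPartialHomeomorph T T)) (f : T → ℝ) (y : T) : ℝ :=
  (1 / (deg S y : ℝ)) * (∑ᶠ z ∈ (orbitGraph S).neighborSet y, f z) - f y

/-! ### Cocycles

A function on the orbit equivalence relation is given by a function of two variables, of which
only the values on the relation are ever used. -/

/-- `δ` is a cocycle on the orbit equivalence relation with positive real values. -/
def IsCocycle (Γ : StructureGroupoid T) (δ : T → T → ℝ) : Prop :=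
  (∀ x y, (x, y) ∈ orbitRel Γ → 0 < δ x y) ∧
    ∀ x y z, (x, y) ∈ orbitRel Γ → (y, z) ∈ orbitRel Γ → δ x y * δ y z = δ x z

/-- `δ` is continuous on the orbit equivalence relation. -/
def IsContinuousCocycle (Γ : StructureGroupoid T) (δ : T → T → ℝ) : Prop :=
  @Continuous (orbitRel Γ) ℝ (etaleTopology Γ) _ fun p => δ p.1.1 p.1.2

/-- `δ` is harmonic: `δ (z, y) = (1 / deg z) ∑_{w ∼ z} δ (w, y)` for all `y` and all `z` in the
orbit of `y`. (For a positive `δ` this includes that every vertex has a neighbour.) -/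
def IsHarmonicCocycle (Γ : StructureGroupoid T) (S : Set (OpenPartialHomeomorph T T))
    (δ : T → T → ℝ) : Prop :=
  ∀ y z, (y, z) ∈ orbitRel Γ →
    δ z y = (1 / (deg S z : ℝ)) * ∑ᶠ w ∈ (orbitGraph S).neighborSet z, δ w y

/-! ### Averaging sequences -/

/-- The weight `|B|_y = ∑_{z ∈ B} δ (z, y)` of a finite subset `B` of the orbit of `y`. -/
def weight (δ : T → T → ℝ) (y : T) (B : Set T) : ℝ := ∑ᶠ z ∈ B, δ z y

/-- The difference set: the points `x ∈ A` with `γ x ∉ A` and the points `x ∉ A` with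
`γ x ∈ A`, where `γ x ∉ A` is understood to hold if `γ x` is not defined. -/
def differenceSet (γ : OpenPartialHomeomorph T T) (A : Set T) : Set T :=
  {x | x ∈ A ∧ ¬ (x ∈ γ.source ∧ γ x ∈ A)} ∪ {x | x ∉ A ∧ x ∈ γ.source ∧ γ x ∈ A}

/-- The nonempty finite sets `A n`, contained in the orbits of the points `y n`, form a
`δ`-averaging sequence. Only the points of the difference sets at which `γ` is defined are
counted; a sequence for which the weights of the full difference sets are negligible is a
fortiori averaging in this sense. -/
structure IsAveragingSequence (Γ : StructureGroupoid T) (S : Set (OpenPartialHomeomorph T T))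
    (δ : T → T → ℝ) (y : ℕ → T) (A : ℕ → Finset T) : Prop where
  nonempty : ∀ n, (A n).Nonempty
  subset_orbit : ∀ n, ∀ z ∈ A n, (y n, z) ∈ orbitRel Γ
  tendsto : ∀ γ ∈ S, Tendsto
    (fun n => weight δ (y n) (differenceSet γ (A n) ∩ γ.source) / weight δ (y n) (A n))
    atTop (𝓝 0)

/-- The limit set of a sequence of sets: the limits of the convergent sequences of points
`u k ∈ A (φ k)` along subsequences. -/
def limitSet (A : ℕ → Finset T) : Set T :=
  {x | ∃ (φ : ℕ → ℕ) (u : ℕ → T), StrictMono φ ∧ (∀ k, u k ∈ A (φ k)) ∧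
    Tendsto u atTop (𝓝 x)}

/-! ### Measures -/

variable [MeasurableSpace T]

/-- `ν` is quasi-invariant: the elements of `Γ` preserve the null sets. -/
def IsQuasiInvariant (Γ : StructureGroupoid T) (ν : Measure T) : Prop :=
  ∀ γ ∈ Γ, ∀ B : Set T, MeasurableSet B → B ⊆ γ.source → (ν (γ '' B) = 0 ↔ ν B = 0)

/-- `ν` has Radon-Nikodym cocycle `δ`, that is `dν (z) = δ (z, y) dν (y)` for `z = γ y`. -/
def HasRadonNikodymCocycle (Γ : StructureGroupoid T) (δ : T → T → ℝ) (ν : Measure T) : Prop :=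
  ∀ γ ∈ Γ, ∀ B : Set T, MeasurableSet B → B ⊆ γ.source →
    ν (γ '' B) = ∫⁻ y in B, ENNReal.ofReal (δ (γ y) y) ∂ν

/-- `ν` is a harmonic measure for the simple random walk: it is quasi-invariant and
`∫ Δ f dν = 0` for all bounded measurable `f`. -/
def IsHarmonicMeasure (Γ : StructureGroupoid T) (S : Set (OpenPartialHomeomorph T T))
    (ν : Measure T) : Prop :=
  IsQuasiInvariant Γ ν ∧
    ∀ f : T → ℝ, Measurable f → (∃ C : ℝ, ∀ x, |f x| ≤ C) →
      Integrable (laplacian S f) ν ∧ ∫ x, laplacian S f x ∂ν = 0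

/-- `ν₀` is the vague limit, along the subsequence `φ`, of the probability measures
`B ↦ |B ∩ A n|_{y n} / |A n|_{y n}`. -/
def IsVagueLimit (δ : T → T → ℝ) (y : ℕ → T) (A : ℕ → Finset T) (φ : ℕ → ℕ)
    (ν₀ : Measure T) : Prop :=
  ∀ f : T → ℝ, Continuous f → HasCompactSupport f →
    Tendsto
      (fun k => (∑ z ∈ A (φ k), f z * δ z (y (φ k))) / weight δ (y (φ k)) (A (φ k)))
      atTop (𝓝 (∫ x, f x ∂ν₀))

end Averaging

end

/-!
The probability measures `B ↦ |B ∩ A n|_{y n} / |A n|_{y n}` have a vaguely convergent subsequence,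
because their images in the one-point compactification have a weakly convergent one. Let `ν₀` be
the limit. For a generator `γ` and a compactly supported continuous `g` on the domain of `γ`, the
integrals of `g ∘ γ⁻¹` and of `x ↦ g x * δ (γ x, x)` against the approximating measures differ by
at most a constant times the relative weight of the difference set of `γ`. Hence `γ` transforms
`ν₀` by `δ`, and the partial homeomorphisms with this property form a pseudogroup.

No mass escapes completely: a path of length at most `N` from a point of `A n` to `T₁` either ends
in `A n ∩ T₁` or crosses a difference set, and by harmonicity the weight of a vertex is bounded by
a constant times the weight of any of its neighbours. So `|A n|` is at most a constant times
`|A n ∩ T₁|`, up to a negligible term, and `ν₀ ≠ 0`.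

Finally, the edges of the orbit graph are covered by finitely many elements of `Γ` restricted to
measurable sets. Pushing `ν₀` forward along all of them gives the density
`x ↦ ∑_{w ∼ x} δ (w, x)`, which is `deg x` since `δ` is harmonic. This says that
`∫ ∑_{w ∼ x} f w dν₀ = ∫ deg x * f x dν₀`, that is, `∫ Δ f d(deg · ν₀) = 0`.
-/

namespace Averaging

section VagueTopology

variable {X : Type*} [TopologicalSpace X] [T2Space X] [LocallyCompactSpace X]
  [SecondCountableTopology X]

lemma secondCountableTopology_onePoint : SecondCountableTopology (OnePoint X) := by
  let b := TopologicalSpace.countableBasis X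
  let K := CompactExhaustion.choice X
  let B : Set (Set (OnePoint X)) :=
    Set.image OnePoint.some '' b ∪ Set.range fun n => (OnePoint.some '' K n)ᶜ
  have hB : TopologicalSpace.IsTopologicalBasis B := by
    refine TopologicalSpace.isTopologicalBasis_of_isOpen_of_nhds ?_ fun a u ha hu => ?_
    · rintro u (⟨s, hs, rfl⟩ | ⟨n, rfl⟩)
      · exact OnePoint.isOpen_image_coe.2 (TopologicalSpace.isOpen_of_mem_countableBasis hs)
      · exact OnePoint.isOpen_compl_image_coe.2 ⟨(K.isCompact n).isClosed, K.isCompact n⟩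
    · cases a using OnePoint.rec with
      | infty =>
        obtain ⟨n, hn⟩ := K.exists_superset_of_isCompact ((OnePoint.isOpen_iff_of_mem ha).1 hu).2
        refine ⟨_, Or.inr ⟨n, rfl⟩, by simp, fun z hz => ?_⟩
        cases z using OnePoint.rec with
        | infty => exact ha
        | coe z => exact not_not.1 fun hzu => hz ⟨z, hn hzu, rfl⟩
      | coe a =>
        obtain ⟨v, hv, hav, hvu⟩ := (TopologicalSpace.isBasis_countableBasis X).mem_nhds_iff.1
          ((hu.preimage OnePoint.continuous_coe).mem_nhds ha)
        exact ⟨_, Or.inl ⟨v, hv, rfl⟩, ⟨a, hav, rfl⟩, Set.image_subset_iff.2 hvu⟩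
  exact hB.secondCountableTopology
    (((TopologicalSpace.countable_countableBasis X).image _).union (Set.countable_range _))

variable [MeasurableSpace X] [BorelSpace X]

lemma exists_subseq_tendsto_vague (μ : ℕ → Measure X) (hμ : ∀ n, IsProbabilityMeasure (μ n)) :
    ∃ (φ : ℕ → ℕ) (ν : Measure X), StrictMono φ ∧ IsFiniteMeasure ν ∧
      ∀ f : X → ℝ, Continuous f → HasCompactSupport f →
        Tendsto (fun k => ∫ x, f x ∂μ (φ k)) atTop (𝓝 (∫ x, f x ∂ν)) := by
  have := secondCountableTopology_onePoint (X := X)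
  let : MeasurableSpace (OnePoint X) := borel _
  have : BorelSpace (OnePoint X) := ⟨rfl⟩
  have hemb : MeasurableEmbedding (OnePoint.some : X → OnePoint X) :=
    OnePoint.isOpenEmbedding_coe.measurableEmbedding
  let P : ℕ → ProbabilityMeasure (OnePoint X) := fun n =>
    ⟨(μ n).map OnePoint.some, Measure.isProbabilityMeasure_map hemb.measurable.aemeasurable⟩
  obtain ⟨ρ, φ, hφ, hlim⟩ := CompactSpace.tendsto_subseq P
  refine ⟨φ, (ρ : Measure (OnePoint X)).comap OnePoint.some, hφ, ⟨?_⟩, fun f hf hfc => ?_⟩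
  · rw [hemb.comap_apply]
    exact measure_lt_top _ _
  · let F : C(OnePoint X, ℝ) := OnePoint.continuousMapMk ⟨f, hf⟩ 0
      (coclosedCompact_eq_cocompact (X := X) ▸ hfc.is_zero_at_infty)
    have integral_F : ∫ z, F z ∂(ρ : Measure (OnePoint X)) =
        ∫ x, f x ∂((ρ : Measure (OnePoint X)).comap OnePoint.some) := by
      rw [← setIntegral_eq_integral_of_forall_compl_eq_zero (s := Set.range OnePoint.some),
        ← hemb.map_comap]
      · exact hemb.integral_map F
      · intro z hz
        rw [OnePoint.notMem_range_coe_iff.1 hz]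
        rfl
    rw [← integral_F]
    refine Tendsto.congr (fun k => hemb.integral_map F)
      (ProbabilityMeasure.tendsto_iff_forall_integral_tendsto.1 hlim
        (BoundedContinuousFunction.mkOfCompact F))

lemma restrict_eq_of_forall_integral_eq {U : Set X} (hU : IsOpen U) {μ₁ μ₂ : Measure X}
    (h₁ : ∀ K ⊆ U, IsCompact K → μ₁ K < ⊤) (h₂ : ∀ K ⊆ U, IsCompact K → μ₂ K < ⊤)
    (h : ∀ f : X → ℝ, Continuous f → HasCompactSupport f → tsupport f ⊆ U →
      ∫ x, f x ∂μ₁ = ∫ x, f x ∂μ₂) :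
    μ₁.restrict U = μ₂.restrict U := by
  have : LocallyCompactSpace U := hU.locallyCompactSpace
  have hemb : MeasurableEmbedding (Subtype.val : U → X) :=
    MeasurableEmbedding.subtype_coe hU.measurableSet
  have isFiniteMeasureOnCompacts {μ : Measure X} (hμ : ∀ K ⊆ U, IsCompact K → μ K < ⊤) :
      IsFiniteMeasureOnCompacts (μ.comap (Subtype.val : U → X)) := by
    refine ⟨fun K hK => ?_⟩
    rw [hemb.comap_apply]
    exact hμ _ (Subtype.coe_image_subset U K) (hK.image continuous_subtype_val)
  have := isFiniteMeasureOnCompacts h₁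
  have := isFiniteMeasureOnCompacts h₂
  suffices μ₁.comap (Subtype.val : U → X) = μ₂.comap Subtype.val by
    rw [← map_comap_subtype_coe hU.measurableSet, this, map_comap_subtype_coe hU.measurableSet]
  refine Measure.ext_of_integral_eq_on_compactlySupported fun f => ?_
  let F : X → ℝ := Subtype.val.extend f 0
  have F_coe : ∀ x : U, F x = f x := Subtype.val_injective.extend_apply f 0
  have F_support : tsupport F ⊆ U :=
    (f.hasCompactSupport.tsupport_extend_zero_subset continuous_subtype_val).trans
      (Subtype.coe_image_subset U _)
  have integral_F (μ : Measure X) : ∫ x, f x ∂μ.comap Subtype.val = ∫ x, F x ∂μ := by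
    simp_rw [← F_coe]
    rw [← hemb.integral_map, hemb.map_comap, Subtype.range_coe,
      setIntegral_eq_integral_of_forall_compl_eq_zero fun x hx =>
        image_eq_zero_of_notMem_tsupport fun hx' => hx (F_support hx')]
  rw [integral_F, integral_F]
  exact h F (f.hasCompactSupport.continuous_extend_zero hU f.continuous)
    (f.hasCompactSupport.extend_zero continuous_subtype_val) F_support

end VagueTopology

section Orbits

variable {T : Type*} [TopologicalSpace T] {Γ : StructureGroupoid T}
  {γ η : OpenPartialHomeomorph T T} {x y z : T} {δ : T → T → ℝ}

lemma orbitRel_apply (hγ : γ ∈ Γ) (hx : x ∈ γ.source) : (x, γ x) ∈ orbitRel Γ :=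
  ⟨γ, hγ, hx, rfl⟩

lemma orbitRel_refl (x : T) : (x, x) ∈ orbitRel Γ :=
  ⟨_, Γ.id_mem, trivial, rfl⟩

lemma orbitRel_symm (h : (x, y) ∈ orbitRel Γ) : (y, x) ∈ orbitRel Γ := by
  obtain ⟨γ, hγ, hx, rfl : γ x = y⟩ := h
  exact ⟨γ.symm, Γ.symm hγ, γ.map_source hx, γ.left_inv hx⟩

lemma orbitRel_trans (h : (x, y) ∈ orbitRel Γ) (h' : (y, z) ∈ orbitRel Γ) :
    (x, z) ∈ orbitRel Γ := by
  obtain ⟨γ, hγ, hx, rfl : γ x = y⟩ := h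
  obtain ⟨η, hη, hy, rfl : η (γ x) = z⟩ := h'
  exact ⟨γ.trans η, Γ.trans hγ hη, by simpa using ⟨hx, hy⟩, rfl⟩

lemma orbitRel_apply_iff (hγ : γ ∈ Γ) (hx : x ∈ γ.source) :
    (y, γ x) ∈ orbitRel Γ ↔ (y, x) ∈ orbitRel Γ :=
  ⟨fun h => orbitRel_trans h (orbitRel_symm (orbitRel_apply hγ hx)),
    fun h => orbitRel_trans h (orbitRel_apply hγ hx)⟩

lemma IsCocycle.self_eq_one (hδ : IsCocycle Γ δ) (x : T) : δ x x = 1 :=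
  (mul_eq_left₀ (hδ.1 x x (orbitRel_refl x)).ne').1
    (hδ.2 x x x (orbitRel_refl x) (orbitRel_refl x))

lemma IsCocycle.apply_pos (hδ : IsCocycle Γ δ) (hγ : γ ∈ Γ) (hx : x ∈ γ.source) :
    0 < δ (γ x) x :=
  hδ.1 _ _ (orbitRel_symm (orbitRel_apply hγ hx))

lemma IsCocycle.apply_mul (hδ : IsCocycle Γ δ) (hγ : γ ∈ Γ) (hx : x ∈ γ.source)
    (hxy : (x, y) ∈ orbitRel Γ) : δ (γ x) x * δ x y = δ (γ x) y :=
  hδ.2 _ _ _ (orbitRel_symm (orbitRel_apply hγ hx)) hxy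

/-- The function `x ↦ δ (γ x, x)` is continuous on the domain of every `γ ∈ Γ`. This is the only
form in which continuity of a cocycle is used. For a free action it follows from continuity for
the étale topology; in general it makes sense without any topology on the orbit relation. -/
def IsContinuousAlong (Γ : StructureGroupoid T) (δ : T → T → ℝ) : Prop :=
  ∀ γ ∈ Γ, ContinuousOn (fun x => δ (γ x) x) γ.source

lemma IsContinuousCocycle.isContinuousAlong (hδ : IsContinuousCocycle Γ δ)
    (hfree : ActsFreely Γ) : IsContinuousAlong Γ δ := by
  intro γ hγ
  rw [continuousOn_iff_continuous_domRestrict]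
  let := etaleTopology Γ
  let pair : γ.source → orbitRel Γ := fun x =>
    ⟨(γ x, x), orbitRel_symm (orbitRel_apply hγ x.2)⟩
  suffices Continuous pair from Continuous.comp hδ this
  refine continuous_generateFrom_iff.2 ?_
  rintro _ ⟨η, hη, rfl⟩
  refine isOpen_iff_mem_nhds.2 ?_
  rintro ⟨x, hx⟩ ⟨hγx : γ x ∈ η.source, hfix : η (γ x) = x⟩
  have hx' : x ∈ (γ.trans η).source := by simpa using ⟨hx, hγx⟩
  have germ_eq_id : ∀ᶠ z in 𝓝 x, z ∈ (γ.trans η).source ∧ (γ.trans η) z = z :=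
    ((γ.trans η).open_source.eventually_mem hx').and (hfree _ (Γ.trans hγ hη) x hx' hfix)
  filter_upwards [continuousAt_subtype_val.eventually germ_eq_id] with z ⟨hz, hfix_z⟩
  rw [OpenPartialHomeomorph.trans_source] at hz
  exact ⟨hz.2, hfix_z⟩

end Orbits

section RadonNikodym

variable {T : Type*} [TopologicalSpace T] [MeasurableSpace T] {Γ : StructureGroupoid T}
  {γ η : OpenPartialHomeomorph T T} {δ : T → T → ℝ} {ν : Measure T} {B : Set T}

/-- The Radon-Nikodym property of `ν` with respect to `δ` along the single partial
homeomorphism `γ`; `HasRadonNikodymCocycle Γ δ ν` asks for it along every `γ ∈ Γ`. -/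
def HasDensityAlong (δ : T → T → ℝ) (ν : Measure T) (γ : OpenPartialHomeomorph T T) : Prop :=
  ∀ B : Set T, MeasurableSet B → B ⊆ γ.source →
    ν (γ '' B) = ∫⁻ y in B, ENNReal.ofReal (δ (γ y) y) ∂ν

namespace HasDensityAlong

lemma refl (hδ : IsCocycle Γ δ) : HasDensityAlong δ ν (OpenPartialHomeomorph.refl T) := by
  intro B _ _
  simp [hδ.self_eq_one]

lemma restr (h : HasDensityAlong δ ν γ) (s : Set T) : HasDensityAlong δ ν (γ.restr s) :=
  fun B hB hBs => h B hB (hBs.trans Set.inter_subset_left)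

lemma of_eqOnSource (h : HasDensityAlong δ ν γ) (hηγ : η ≈ γ) : HasDensityAlong δ ν η := by
  intro B hB hBs
  have heq : Set.EqOn η γ B := hηγ.2.mono hBs
  rw [heq.image_eq, h B hB (hBs.trans hηγ.1.subset)]
  exact setLIntegral_congr_fun hB fun x hx => by simp only [heq hx]

end HasDensityAlong

variable [BorelSpace T]

lemma measurableSet_inter_preimage (γ : OpenPartialHomeomorph T T) {C : Set T}
    (hB : MeasurableSet B) (hBs : B ⊆ γ.source) (hC : MeasurableSet C) :
    MeasurableSet (B ∩ γ ⁻¹' C) := by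
  have hγ : Measurable (B.domRestrict γ) :=
    (continuousOn_iff_continuous_domRestrict.1 (γ.continuousOn.mono hBs)).measurable
  have := hB.subtype_image (hγ hC)
  rwa [Set.domRestrict_eq, Set.preimage_comp, Subtype.image_preimage_coe] at this

lemma measurableSet_image (γ : OpenPartialHomeomorph T T) (hB : MeasurableSet B)
    (hBs : B ⊆ γ.source) : MeasurableSet (γ '' B) := by
  rw [γ.image_eq_target_inter_inv_preimage hBs]
  exact measurableSet_inter_preimage γ.symm γ.open_target.measurableSet subset_rfl hB

lemma aemeasurable_restrict (γ : OpenPartialHomeomorph T T) (hB : MeasurableSet B)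
    (hBs : B ⊆ γ.source) : AEMeasurable γ (ν.restrict B) :=
  (γ.continuousOn.mono hBs).aemeasurable hB

lemma forall_measure_image_eq_iff_restrict_eq {U : Set T} (hU : MeasurableSet U)
    (hUs : U ⊆ γ.source) {ρ : T → ENNReal} :
    (∀ B, MeasurableSet B → B ⊆ U → ν (γ '' B) = ∫⁻ y in B, ρ y ∂ν) ↔
      ((ν.restrict γ.target).map γ.symm).restrict U = (ν.withDensity ρ).restrict U := by
  have map_apply {B : Set T} (hB : MeasurableSet B) (hBs : B ⊆ γ.source) :
      (ν.restrict γ.target).map γ.symm B = ν (γ '' B) := by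
    rw [Measure.map_apply_of_aemeasurable
        (aemeasurable_restrict γ.symm γ.open_target.measurableSet subset_rfl) hB,
      Measure.restrict_apply' γ.open_target.measurableSet, Set.inter_comm,
      γ.image_eq_target_inter_inv_preimage hBs]
  refine ⟨fun h => Measure.ext fun B hB => ?_, fun h B hB hBU => ?_⟩
  · rw [Measure.restrict_apply hB, Measure.restrict_apply hB,
      map_apply (hB.inter hU) (Set.inter_subset_right.trans hUs),
      withDensity_apply _ (hB.inter hU), h _ (hB.inter hU) Set.inter_subset_right]
  · have := congr($h B)
    rwa [Measure.restrict_eq_self _ hBU, Measure.restrict_eq_self _ hBU,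
      map_apply hB (hBU.trans hUs), withDensity_apply _ hB] at this

lemma hasDensityAlong_iff_restrict_eq : HasDensityAlong δ ν γ ↔
    ((ν.restrict γ.target).map γ.symm).restrict γ.source =
      (ν.withDensity fun y => ENNReal.ofReal (δ (γ y) y)).restrict γ.source :=
  forall_measure_image_eq_iff_restrict_eq γ.open_source.measurableSet subset_rfl

namespace HasDensityAlong

lemma map_withDensity (h : HasDensityAlong δ ν γ) (hB : MeasurableSet B) (hBs : B ⊆ γ.source) :
    ((ν.restrict B).withDensity fun y => ENNReal.ofReal (δ (γ y) y)).map γ =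
      ν.restrict (γ '' B) := by
  have hγ : AEMeasurable γ (ν.restrict B) := aemeasurable_restrict γ hB hBs
  ext C hC
  rw [Measure.map_apply_of_aemeasurable (hγ.mono_ac (withDensity_absolutelyContinuous _ _)) hC,
    withDensity_apply₀ _ (hγ.nullMeasurable hC), Measure.restrict_restrict' hB, Set.inter_comm,
    ← h _ (measurableSet_inter_preimage γ hB hBs hC) (Set.inter_subset_left.trans hBs),
    Measure.restrict_apply hC, Set.image_inter_preimage, Set.inter_comm]

lemma lintegral_image (h : HasDensityAlong δ ν γ)
    (hδγ : ContinuousOn (fun y => δ (γ y) y) γ.source) (hB : MeasurableSet B)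
    (hBs : B ⊆ γ.source) {g : T → ENNReal} (hg : AEMeasurable g (ν.restrict (γ '' B))) :
    ∫⁻ z in γ '' B, g z ∂ν = ∫⁻ y in B, ENNReal.ofReal (δ (γ y) y) * g (γ y) ∂ν := by
  rw [← h.map_withDensity hB hBs] at hg ⊢
  rw [lintegral_map' hg ((aemeasurable_restrict γ hB hBs).mono_ac
      (withDensity_absolutelyContinuous _ _)),
    lintegral_withDensity_eq_lintegral_mul_non_measurable₀ _
      ((hδγ.mono hBs).aemeasurable hB).ennreal_ofReal (by simp)]
  rfl

lemma trans (h : HasDensityAlong δ ν γ) (h' : HasDensityAlong δ ν η) (hδ : IsCocycle Γ δ)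
    (hδcont : IsContinuousAlong Γ δ) (hγ : γ ∈ Γ) (hη : η ∈ Γ) :
    HasDensityAlong δ ν (γ.trans η) := by
  intro B hB hBs
  rw [OpenPartialHomeomorph.trans_source] at hBs
  have hBγ : B ⊆ γ.source := hBs.trans Set.inter_subset_left
  have hγB : γ '' B ⊆ η.source := Set.image_subset_iff.2 (hBs.trans Set.inter_subset_right)
  have hγBm := measurableSet_image γ hB hBγ
  calc ν (γ.trans η '' B) = ∫⁻ z in γ '' B, ENNReal.ofReal (δ (η z) z) ∂ν := by
        rw [OpenPartialHomeomorph.coe_trans, Set.image_comp, h' _ hγBm hγB]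
    _ = ∫⁻ x in B, ENNReal.ofReal (δ (γ x) x) * ENNReal.ofReal (δ (η (γ x)) (γ x)) ∂ν :=
        h.lintegral_image (hδcont γ hγ) hB hBγ
          (((hδcont η hη).mono hγB).aemeasurable hγBm).ennreal_ofReal
    _ = ∫⁻ x in B, ENNReal.ofReal (δ (γ.trans η x) x) ∂ν := by
        refine setLIntegral_congr_fun hB fun x hx => ?_
        rw [← ENNReal.ofReal_mul (hδ.apply_pos hγ (hBγ hx)).le, mul_comm,
          hδ.apply_mul hη (hBs hx).2 (orbitRel_symm (orbitRel_apply hγ (hBγ hx))),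
          OpenPartialHomeomorph.coe_trans, Function.comp_apply]

lemma symm (h : HasDensityAlong δ ν γ) (hδ : IsCocycle Γ δ) (hδcont : IsContinuousAlong Γ δ)
    (hγ : γ ∈ Γ) : HasDensityAlong δ ν γ.symm := by
  intro B hB hBt
  have hm : MeasurableSet (γ.symm '' B) := measurableSet_image γ.symm hB hBt
  have hs : γ.symm '' B ⊆ γ.source := Set.image_subset_iff.2 fun x hx => γ.map_target (hBt hx)
  have image_image_symm : γ '' (γ.symm '' B) = B := by
    rw [Set.image_image, Set.image_congr fun x hx => γ.right_inv (hBt hx), Set.image_id']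
  have hρ : AEMeasurable (fun z => ENNReal.ofReal (δ (γ.symm z) z)) (ν.restrict B) :=
    (((hδcont _ (Γ.symm hγ)).mono hBt).aemeasurable hB).ennreal_ofReal
  calc ν (γ.symm '' B)
      = ∫⁻ x in γ.symm '' B, ENNReal.ofReal (δ (γ x) x) *
          ENNReal.ofReal (δ (γ.symm (γ x)) (γ x)) ∂ν := by
        rw [← setLIntegral_one]
        refine setLIntegral_congr_fun hm fun x hx => ?_
        rw [← ENNReal.ofReal_mul (hδ.apply_pos hγ (hs hx)).le, γ.left_inv (hs hx),
          hδ.2 _ _ _ (orbitRel_symm (orbitRel_apply hγ (hs hx))) (orbitRel_apply hγ (hs hx)),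
          hδ.self_eq_one, ENNReal.ofReal_one]
    _ = ∫⁻ z in B, ENNReal.ofReal (δ (γ.symm z) z) ∂ν := by
        rw [← h.lintegral_image (g := fun z => ENNReal.ofReal (δ (γ.symm z) z)) (hδcont γ hγ)
          hm hs (by rwa [image_image_symm]), image_image_symm]

lemma of_locally [SecondCountableTopology T]
    (h : ∀ x ∈ γ.source, ∃ s, IsOpen s ∧ x ∈ s ∧ HasDensityAlong δ ν (γ.restr s)) :
    HasDensityAlong δ ν γ := by
  choose! s hso hxs hs using h
  obtain ⟨t, hts, htc, ht⟩ := TopologicalSpace.countable_cover_nhdsWithin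
    (f := s) (s := γ.source) fun x hx =>
      mem_nhdsWithin_of_mem_nhds ((hso x hx).mem_nhds (hxs x hx))
  have source_eq : γ.source = ⋃ x ∈ t, γ.source ∩ s x := by
    rw [← Set.inter_iUnion₂, Set.inter_eq_left.2 ht]
  rw [hasDensityAlong_iff_restrict_eq, source_eq, Measure.restrict_biUnion_congr htc]
  intro x hx
  refine (forall_measure_image_eq_iff_restrict_eq
    (γ.open_source.inter (hso x (hts hx))).measurableSet Set.inter_subset_left).1 ?_
  intro B hB hBs
  exact hs x (hts hx) B hB (by rwa [γ.restr_source' _ (hso x (hts hx))])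

end HasDensityAlong

lemma hasRadonNikodymCocycle_of_generates [SecondCountableTopology T] [ClosedUnderRestriction Γ]
    {S : Set (OpenPartialHomeomorph T T)} (hS : Generates Γ S) (hδ : IsCocycle Γ δ)
    (hδcont : IsContinuousAlong Γ δ) (h : ∀ γ ∈ S, HasDensityAlong δ ν γ) :
    HasRadonNikodymCocycle Γ δ ν := by
  let G : StructureGroupoid T :=
    { members := {γ | γ ∈ Γ ∧ HasDensityAlong δ ν γ}
      trans' := fun _ _ he he' => ⟨Γ.trans he.1 he'.1, he.2.trans he'.2 hδ hδcont he.1 he'.1⟩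
      symm' := fun _ he => ⟨Γ.symm he.1, he.2.symm hδ hδcont he.1⟩
      id_mem' := ⟨Γ.id_mem, .refl hδ⟩
      locality' := fun _ he =>
        ⟨Γ.locality fun x hx => (he x hx).imp fun _ hs => ⟨hs.1, hs.2.1, hs.2.2.1⟩,
          .of_locally fun x hx => (he x hx).imp fun _ hs => ⟨hs.1, hs.2.1, hs.2.2.2⟩⟩
      mem_of_eqOnSource' := fun _ _ he hee' =>
        ⟨Γ.mem_of_eqOnSource he.1 hee', he.2.of_eqOnSource hee'⟩ }
  have closedUnderRestriction_G : ClosedUnderRestriction G :=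
    ⟨fun he s hs => ⟨closedUnderRestriction' he.1 hs, he.2.restr s⟩⟩
  exact fun γ hγ => (hS.2 G closedUnderRestriction_G (fun η hη => ⟨hS.1 η hη, h η hη⟩) hγ).2

lemma HasRadonNikodymCocycle.measure_image_eq_zero_iff (h : HasRadonNikodymCocycle Γ δ ν)
    (hδ : IsCocycle Γ δ) (hδcont : IsContinuousAlong Γ δ) (hγ : γ ∈ Γ) (hB : MeasurableSet B)
    (hBs : B ⊆ γ.source) : ν (γ '' B) = 0 ↔ ν B = 0 := by
  have hρ : AEMeasurable (fun y => ENNReal.ofReal (δ (γ y) y)) (ν.restrict B) :=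
    (((hδcont γ hγ).mono hBs).aemeasurable hB).ennreal_ofReal
  rw [h γ hγ B hB hBs, setLIntegral_eq_zero_iff' hB hρ, ae_iff]
  congr! 2
  ext x
  simp only [Classical.not_imp, ENNReal.ofReal_eq_zero, not_le, Set.mem_ofPred_eq]
  exact and_iff_left_of_imp fun hx => hδ.apply_pos hγ (hBs hx)

end RadonNikodym

section OrbitGraph

variable {T : Type*} [TopologicalSpace T] {Γ : StructureGroupoid T}
  {S : Set (OpenPartialHomeomorph T T)} {y z w : T} {δ : T → T → ℝ}

lemma orbitGraph_adj_iff : (orbitGraph S).Adj z w ↔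
    z ≠ w ∧ ∃ γ ∈ S ∪ OpenPartialHomeomorph.symm '' S, z ∈ γ.source ∧ γ z = w := by
  simp only [orbitGraph, SimpleGraph.fromRel_adj, Set.mem_union, or_and_right, exists_or,
    Set.exists_mem_image, OpenPartialHomeomorph.symm_source]
  refine and_congr_right fun _ => or_congr_right (exists_congr fun γ => and_congr_right fun _ => ?_)
  constructor
  · rintro ⟨hw, rfl⟩
    exact ⟨γ.map_source hw, γ.left_inv hw⟩
  · rintro ⟨hz, rfl⟩
    exact ⟨γ.map_target hz, γ.right_inv hz⟩

lemma mem_of_mem_union_symm (hS : ∀ γ ∈ S, γ ∈ Γ) {γ : OpenPartialHomeomorph T T}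
    (hγ : γ ∈ S ∪ OpenPartialHomeomorph.symm '' S) : γ ∈ Γ := by
  rcases hγ with hγ | ⟨η, hη, rfl⟩
  · exact hS γ hγ
  · exact Γ.symm (hS η hη)

lemma orbitRel_of_adj (hS : ∀ γ ∈ S, γ ∈ Γ) (h : (orbitGraph S).Adj z w) :
    (z, w) ∈ orbitRel Γ := by
  obtain ⟨-, γ, hγ, hz, rfl⟩ := orbitGraph_adj_iff.1 h
  exact orbitRel_apply (mem_of_mem_union_symm hS hγ) hz

lemma exists_deg_le (hS : S.Finite) : ∃ m, ∀ z, deg S z ≤ m := by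
  have hfin : (S ∪ OpenPartialHomeomorph.symm '' S).Finite := hS.union (hS.image _)
  refine ⟨(S ∪ OpenPartialHomeomorph.symm '' S).ncard, fun z => ?_⟩
  refine (Set.ncard_le_ncard (fun w hw => ?_) (hfin.image fun γ => γ z)).trans
    (Set.ncard_image_le hfin)
  obtain ⟨-, γ, hγ, -, rfl⟩ := orbitGraph_adj_iff.1 hw
  exact ⟨γ, hγ, rfl⟩

namespace IsHarmonicCocycle

lemma deg_pos (hδharm : IsHarmonicCocycle Γ S δ) (hδ : IsCocycle Γ δ) (z : T) : 0 < deg S z := by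
  refine Nat.pos_of_ne_zero fun h => ?_
  have := hδharm z z (orbitRel_refl z)
  simp [hδ.self_eq_one, h] at this

lemma finite_neighborSet (hδharm : IsHarmonicCocycle Γ S δ) (hδ : IsCocycle Γ δ) (z : T) :
    ((orbitGraph S).neighborSet z).Finite :=
  Set.finite_of_ncard_pos (hδharm.deg_pos hδ z)

lemma finsum_eq (hδharm : IsHarmonicCocycle Γ S δ) (hδ : IsCocycle Γ δ)
    (h : (y, z) ∈ orbitRel Γ) :
    ∑ᶠ w ∈ (orbitGraph S).neighborSet z, δ w y = deg S z * δ z y := by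
  have hdeg : (deg S z : ℝ) ≠ 0 := Nat.cast_ne_zero.2 (hδharm.deg_pos hδ z).ne'
  rw [hδharm y z h, one_div, mul_inv_cancel_left₀ hdeg]

lemma finsum_ofReal_eq (hδharm : IsHarmonicCocycle Γ S δ) (hδ : IsCocycle Γ δ)
    (hS : ∀ γ ∈ S, γ ∈ Γ) (z : T) :
    ∑ᶠ w ∈ (orbitGraph S).neighborSet z, ENNReal.ofReal (δ w z) = deg S z := by
  have hfin := hδharm.finite_neighborSet hδ z
  have := hδharm.finsum_eq hδ (orbitRel_refl z)
  rw [finsum_mem_eq_finite_toFinset_sum _ hfin] at this ⊢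
  rw [← ENNReal.ofReal_sum_of_nonneg, this, hδ.self_eq_one, mul_one, ENNReal.ofReal_natCast]
  exact fun w hw => (hδ.1 _ _ (orbitRel_symm (orbitRel_of_adj hS (hfin.mem_toFinset.1 hw)))).le

end IsHarmonicCocycle

end OrbitGraph

section EdgeDecomposition

variable {T : Type*} [TopologicalSpace T] [MeasurableSpace T] {Γ : StructureGroupoid T}
  {S : Set (OpenPartialHomeomorph T T)}

/-- A finite family of elements `e i ∈ Γ`, restricted to measurable sets `B i`, which runs through
every oriented edge `(z, w)` of the orbit graph exactly once: the edges leaving `z` are the pairs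
`(z, e i z)` with `z ∈ B i`, and they are distinct for distinct `i`. The `B i` need not be open,
which is why they are not made part of the `e i`. -/
structure IsEdgeDecomposition (Γ : StructureGroupoid T) (S : Set (OpenPartialHomeomorph T T))
    {ι : Type*} (e : ι → OpenPartialHomeomorph T T) (B : ι → Set T) : Prop where
  mem : ∀ i, e i ∈ Γ
  subset_source : ∀ i, B i ⊆ (e i).source
  measurableSet : ∀ i, MeasurableSet (B i)
  adj_iff : ∀ z w, (orbitGraph S).Adj z w ↔ ∃ i, z ∈ B i ∧ e i z = w
  injOn : ∀ z, Set.InjOn (fun i => e i z) {i | z ∈ B i}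

lemma measurableSet_coincidence [T2Space T] [BorelSpace T] (γ η : OpenPartialHomeomorph T T) :
    MeasurableSet {x ∈ γ.source ∩ η.source | γ x = η x} := by
  have hopen : IsOpen (γ.source ∩ η.source) := γ.open_source.inter η.open_source
  have hne : IsOpen ((γ.source ∩ η.source) ∩ (fun x => (γ x, η x)) ⁻¹' (Set.diagonal T)ᶜ) :=
    ((γ.continuousOn.mono Set.inter_subset_left).prodMk
      (η.continuousOn.mono Set.inter_subset_right)).isOpen_inter_preimage hopen
        isClosed_diagonal.isOpen_compl
  convert hopen.measurableSet.diff hne.measurableSet using 1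
  ext x
  simp only [Set.mem_ofPred_eq, Set.mem_sdiff, Set.mem_inter_iff, Set.mem_preimage,
    Set.mem_compl_iff, Set.mem_diagonal_iff]
  tauto

lemma exists_isEdgeDecomposition [T2Space T] [BorelSpace T] (hS : ∀ γ ∈ S, γ ∈ Γ)
    (hSfin : S.Finite) :
    ∃ (m : ℕ) (e : Fin m → OpenPartialHomeomorph T T) (B : Fin m → Set T),
      IsEdgeDecomposition Γ S e B := by
  obtain ⟨m, e, -, he⟩ := (hSfin.union (hSfin.image OpenPartialHomeomorph.symm)).fin_param
  let new (i : Fin m) : Set T := {x | e i x ≠ x ∧ ∀ j < i, x ∈ (e j).source → e j x ≠ e i x}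
  have measurableSet_new (i) : MeasurableSet ((e i).source ∩ new i) := by
    convert ((e i).open_source.measurableSet.diff (measurableSet_coincidence (e i) (.refl T))).diff
      (MeasurableSet.iUnion fun j => MeasurableSet.iUnion fun _ : j < i =>
        measurableSet_coincidence (e j) (e i)) using 1
    ext x
    simp only [new, Set.mem_inter_iff, Set.mem_sdiff, Set.mem_iUnion, Set.mem_ofPred_eq,
      OpenPartialHomeomorph.refl_source, OpenPartialHomeomorph.refl_apply]
    grind
  refine ⟨m, e, fun i => (e i).source ∩ new i, fun i => ?_, fun i => Set.inter_subset_left,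
    measurableSet_new, fun z w => ?_, fun z i hi j hj hij => ?_⟩
  · exact mem_of_mem_union_symm hS (he ▸ Set.mem_range_self i)
  · rw [orbitGraph_adj_iff, ← he]
    constructor
    · rintro ⟨hne, _, ⟨i₀, rfl⟩, hi₀⟩
      obtain ⟨i, ⟨hi, rfl⟩, hmin⟩ := wellFounded_lt.has_min
        {i | z ∈ (e i).source ∧ e i z = w} ⟨i₀, hi₀⟩
      exact ⟨i, ⟨hi, hne.symm, fun j hji hj h => hmin j ⟨hj, h⟩ hji⟩, rfl⟩
    · rintro ⟨i, ⟨hi, hne, -⟩, rfl⟩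
      exact ⟨hne.symm, e i, ⟨i, rfl⟩, hi, rfl⟩
  · rcases lt_trichotomy i j with h | h | h
    · exact absurd hij (hj.2.2 i h hi.1)
    · exact h
    · exact absurd hij.symm (hi.2.2 j h hj.1)

namespace IsEdgeDecomposition

variable {ι : Type*} {e : ι → OpenPartialHomeomorph T T} {B : ι → Set T}

lemma symm_image_image (h : IsEdgeDecomposition Γ S e B) (i : ι) (C : Set T) :
    (e i).symm '' (e i '' B i ∩ C) = B i ∩ e i ⁻¹' C := by
  rw [← Set.image_inter_preimage, Set.image_image,
    Set.image_congr fun x hx => (e i).left_inv (h.subset_source i hx.1), Set.image_id']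

lemma symm [BorelSpace T] (h : IsEdgeDecomposition Γ S e B) :
    IsEdgeDecomposition Γ S (fun i => (e i).symm) (fun i => e i '' B i) where
  mem i := Γ.symm (h.mem i)
  subset_source i := Set.image_subset_iff.2 fun x hx => (e i).map_source (h.subset_source i hx)
  measurableSet i := measurableSet_image (e i) (h.measurableSet i) (h.subset_source i)
  adj_iff z w := by
    rw [SimpleGraph.adj_comm, h.adj_iff]
    refine exists_congr fun i => ⟨?_, ?_⟩
    · rintro ⟨hw, rfl⟩
      exact ⟨⟨w, hw, rfl⟩, (e i).left_inv (h.subset_source i hw)⟩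
    · rintro ⟨⟨x, hx, rfl⟩, rfl⟩
      rw [(e i).left_inv (h.subset_source i hx)]
      exact ⟨hx, rfl⟩
  injOn z i hi j hj hij := by
    obtain ⟨x, hx, rfl⟩ := hi
    obtain ⟨x', hx', hxx'⟩ := hj
    have : x = x' := by
      rw [← (e i).left_inv (h.subset_source i hx), ← (e j).left_inv (h.subset_source j hx'), hxx']
      exact hij
    subst this
    exact h.injOn x hx hx' hxx'.symm

open Classical in
lemma finsum_neighborSet [Fintype ι] {M : Type*} [AddCommMonoid M]
    (h : IsEdgeDecomposition Γ S e B) (g : T → M) (z : T) :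
    ∑ᶠ w ∈ (orbitGraph S).neighborSet z, g w =
      ∑ i, (B i).indicator (fun x => g (e i x)) z := by
  have neighborSet_eq : (orbitGraph S).neighborSet z =
      ((Finset.univ.filter fun i => z ∈ B i).image fun i => e i z : Finset T) := by
    ext w
    simp [h.adj_iff]
  rw [neighborSet_eq, finsum_mem_coe_finset, Finset.sum_image (by simpa using h.injOn z),
    Finset.sum_filter]
  rfl

lemma measurable_deg [Finite ι] (h : IsEdgeDecomposition Γ S e B) : Measurable (deg S) := by
  cases nonempty_fintype ι
  have deg_eq (z : T) : deg S z = ∑ i, (B i).indicator (fun _ => 1) z := by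
    rw [← h.finsum_neighborSet (fun _ => 1), finsum_one, deg]
  rw [funext deg_eq]
  exact Finset.measurable_sum _ fun i _ => measurable_const.indicator (h.measurableSet i)

lemma measurable_deg_ennreal [Finite ι] (h : IsEdgeDecomposition Γ S e B) :
    Measurable fun x => (deg S x : ENNReal) :=
  (measurable_of_countable (fun n : ℕ => (n : ENNReal))).comp h.measurable_deg

end IsEdgeDecomposition

end EdgeDecomposition

section HarmonicMeasure

variable {T : Type*} [TopologicalSpace T] [MeasurableSpace T] {Γ : StructureGroupoid T}
  {S : Set (OpenPartialHomeomorph T T)} {δ : T → T → ℝ} {ν : Measure T}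

lemma isFiniteMeasure_withDensity_deg [IsFiniteMeasure ν] (hSfin : S.Finite) :
    IsFiniteMeasure (ν.withDensity fun x => (deg S x : ENNReal)) := by
  obtain ⟨m, hm⟩ := exists_deg_le hSfin
  refine isFiniteMeasure_withDensity (ne_of_lt ?_)
  calc ∫⁻ x, (deg S x : ENNReal) ∂ν ≤ ∫⁻ _x, (m : ENNReal) ∂ν :=
        lintegral_mono fun x => Nat.cast_le.2 (hm x)
    _ = m * ν Set.univ := lintegral_const _
    _ < ⊤ := ENNReal.mul_lt_top (ENNReal.natCast_lt_top m) (measure_lt_top ν _)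

variable [BorelSpace T]

namespace IsEdgeDecomposition

variable {ι : Type*} {e : ι → OpenPartialHomeomorph T T} {B : ι → Set T}

lemma sum_map_restrict [Fintype ι] (h : IsEdgeDecomposition Γ S e B) (hS : ∀ γ ∈ S, γ ∈ Γ)
    (hδ : IsCocycle Γ δ) (hδcont : IsContinuousAlong Γ δ) (hδharm : IsHarmonicCocycle Γ S δ)
    (hν : HasRadonNikodymCocycle Γ δ ν) :
    ∑ i, (ν.restrict (B i)).map (e i) = ν.withDensity fun x => (deg S x : ENNReal) := by
  let ρ (i : ι) (x : T) : ENNReal := ENNReal.ofReal (δ ((e i).symm x) x)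
  have hρ (i) : AEMeasurable ((e i '' B i).indicator (ρ i)) ν :=
    (aemeasurable_indicator_iff (h.symm.measurableSet i)).2
      (((hδcont _ (h.symm.mem i)).mono (h.symm.subset_source i)).aemeasurable
        (h.symm.measurableSet i)).ennreal_ofReal
  have sum_density (x : T) : ∑ i, (e i '' B i).indicator (ρ i) x = deg S x :=
    (h.symm.finsum_neighborSet (fun w => ENNReal.ofReal (δ w x)) x).symm.trans
      (hδharm.finsum_ofReal_eq hδ hS x)
  have map_apply (i) {C : Set T} (hC : MeasurableSet C) :
      (ν.restrict (B i)).map (e i) C = ∫⁻ x in C, (e i '' B i).indicator (ρ i) x ∂ν := by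
    rw [Measure.map_apply_of_aemeasurable
        (aemeasurable_restrict (e i) (h.measurableSet i) (h.subset_source i)) hC,
      Measure.restrict_apply' (h.measurableSet i), Set.inter_comm, ← h.symm_image_image,
      hν _ (h.symm.mem i) _ ((h.symm.measurableSet i).inter hC)
        (Set.inter_subset_left.trans (h.symm.subset_source i)),
      ← Measure.restrict_restrict (h.symm.measurableSet i),
      lintegral_indicator (h.symm.measurableSet i)]
  ext C hC
  simp_rw [Measure.finsetSum_apply, map_apply _ hC, withDensity_apply _ hC, ← sum_density]
  exact (lintegral_finsetSum' _ fun i _ => (hρ i).restrict).symm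

lemma integral_finsum_neighborSet [Finite ι] (h : IsEdgeDecomposition Γ S e B) (hS : ∀ γ ∈ S, γ ∈ Γ)
    (hδ : IsCocycle Γ δ) (hδcont : IsContinuousAlong Γ δ) (hδharm : IsHarmonicCocycle Γ S δ)
    (hν : HasRadonNikodymCocycle Γ δ ν) {f : T → ℝ}
    (hf : Integrable f (ν.withDensity fun x => (deg S x : ENNReal))) :
    Integrable (fun x => ∑ᶠ w ∈ (orbitGraph S).neighborSet x, f w) ν ∧
      ∫ x, ∑ᶠ w ∈ (orbitGraph S).neighborSet x, f w ∂ν =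
        ∫ x, f x ∂(ν.withDensity fun x => (deg S x : ENNReal)) := by
  cases nonempty_fintype ι
  rw [← h.sum_map_restrict hS hδ hδcont hδharm hν, integrable_finsetSum_measure] at hf
  have he (i) : AEMeasurable (e i) (ν.restrict (B i)) :=
    aemeasurable_restrict (e i) (h.measurableSet i) (h.subset_source i)
  have hfe (i) : Integrable ((B i).indicator fun x => f (e i x)) ν :=
    (integrable_indicator_iff (h.measurableSet i)).2
      ((hf i (Finset.mem_univ i)).comp_aemeasurable (he i))
  simp_rw [h.finsum_neighborSet f]
  refine ⟨integrable_finsetSum _ fun i _ => hfe i, ?_⟩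
  rw [← h.sum_map_restrict hS hδ hδcont hδharm hν, integral_finsetSum_measure hf,
    integral_finsetSum _ fun i _ => hfe i]
  refine Finset.sum_congr rfl fun i hi => ?_
  rw [integral_map (he i) (hf i hi).aestronglyMeasurable, integral_indicator (h.measurableSet i)]

lemma integral_laplacian_withDensity_deg [Finite ι] (h : IsEdgeDecomposition Γ S e B)
    (hS : ∀ γ ∈ S, γ ∈ Γ) (hδ : IsCocycle Γ δ) (hδcont : IsContinuousAlong Γ δ)
    (hδharm : IsHarmonicCocycle Γ S δ) (hν : HasRadonNikodymCocycle Γ δ ν) {f : T → ℝ}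
    (hf : Integrable f (ν.withDensity fun x => (deg S x : ENNReal))) :
    Integrable (laplacian S f) (ν.withDensity fun x => (deg S x : ENNReal)) ∧
      ∫ x, laplacian S f x ∂(ν.withDensity fun x => (deg S x : ENNReal)) = 0 := by
  have hdeg := h.measurable_deg_ennreal
  have deg_lt_top : ∀ᵐ x ∂ν, (deg S x : ENNReal) < ⊤ := .of_forall fun x => by simp
  have deg_smul_laplacian (x : T) : (deg S x : ENNReal).toReal • laplacian S f x =
      (∑ᶠ w ∈ (orbitGraph S).neighborSet x, f w) - (deg S x : ENNReal).toReal • f x := by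
    have : (deg S x : ℝ) ≠ 0 := Nat.cast_ne_zero.2 (hδharm.deg_pos hδ x).ne'
    rw [ENNReal.toReal_natCast, smul_eq_mul, smul_eq_mul, laplacian]
    field_simp
  obtain ⟨hsum, integral_sum⟩ := h.integral_finsum_neighborSet hS hδ hδcont hδharm hν hf
  have hdegf := (integrable_withDensity_iff_integrable_smul' hdeg deg_lt_top).1 hf
  rw [integrable_withDensity_iff_integrable_smul' hdeg deg_lt_top,
    integral_withDensity_eq_integral_toReal_smul hdeg deg_lt_top]
  simp_rw [deg_smul_laplacian]
  refine ⟨hsum.sub hdegf, ?_⟩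
  rw [integral_sub hsum hdegf, integral_sum,
    integral_withDensity_eq_integral_toReal_smul hdeg deg_lt_top, sub_self]

end IsEdgeDecomposition

variable [T2Space T]

lemma withDensity_deg_eq_zero_iff (hS : ∀ γ ∈ S, γ ∈ Γ) (hSfin : S.Finite)
    (hδ : IsCocycle Γ δ) (hδharm : IsHarmonicCocycle Γ S δ) (B : Set T) :
    ν.withDensity (fun x => (deg S x : ENNReal)) B = 0 ↔ ν B = 0 := by
  obtain ⟨m, e, E, hE⟩ := exists_isEdgeDecomposition hS hSfin
  have support_deg : {x | (deg S x : ENNReal) ≠ 0} = Set.univ :=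
    Set.eq_univ_of_forall fun x => Nat.cast_ne_zero.2 (hδharm.deg_pos hδ x).ne'
  rw [withDensity_apply_eq_zero hE.measurable_deg_ennreal, support_deg, Set.univ_inter]

lemma isHarmonicMeasure_withDensity_deg [IsFiniteMeasure ν] (hS : ∀ γ ∈ S, γ ∈ Γ)
    (hSfin : S.Finite) (hδ : IsCocycle Γ δ) (hδcont : IsContinuousAlong Γ δ)
    (hδharm : IsHarmonicCocycle Γ S δ) (hν : HasRadonNikodymCocycle Γ δ ν) :
    IsHarmonicMeasure Γ S (ν.withDensity fun x => (deg S x : ENNReal)) := by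
  refine ⟨fun γ hγ B hB hBs => ?_, ?_⟩
  · rw [withDensity_deg_eq_zero_iff hS hSfin hδ hδharm,
      withDensity_deg_eq_zero_iff hS hSfin hδ hδharm]
    exact hν.measure_image_eq_zero_iff hδ hδcont hγ hB hBs
  · rintro f hf ⟨C, hC⟩
    obtain ⟨m, e, E, hE⟩ := exists_isEdgeDecomposition hS hSfin
    have := isFiniteMeasure_withDensity_deg (ν := ν) hSfin
    exact hE.integral_laplacian_withDensity_deg hS hδ hδcont hδharm hν
      (.of_bound hf.aestronglyMeasurable C (.of_forall hC))

end HarmonicMeasure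

section Weight

lemma sum_le_sum_sum_of_cover {ι κ : Type*} {s : Finset ι} {t : Finset κ} {u : κ → Finset ι}
    {w : ι → ℝ} (hu : ∀ i ∈ s, ∃ k ∈ t, i ∈ u k) (hw : ∀ k ∈ t, ∀ i ∈ u k, 0 ≤ w i) :
    ∑ i ∈ s, w i ≤ ∑ k ∈ t, ∑ i ∈ u k, w i := by
  classical
  have subset_image : s ⊆ (t.sigma u).image Sigma.snd := fun i hi =>
    let ⟨k, hk, hik⟩ := hu i hi
    Finset.mem_image_of_mem Sigma.snd (Finset.mem_sigma.2 ⟨hk, hik⟩ : ⟨k, i⟩ ∈ t.sigma u)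
  have nonneg : ∀ i ∈ (t.sigma u).image Sigma.snd, 0 ≤ w i := Finset.forall_mem_image.2
    fun x hx => hw x.1 (Finset.mem_sigma.1 hx).1 x.2 (Finset.mem_sigma.1 hx).2
  calc ∑ i ∈ s, w i ≤ ∑ i ∈ (t.sigma u).image Sigma.snd, w i :=
        Finset.sum_le_sum_of_subset_of_nonneg subset_image fun i hi _ => nonneg i hi
    _ ≤ ∑ x ∈ t.sigma u, w x.2 := Finset.sum_image_le_of_nonneg nonneg
    _ = ∑ k ∈ t, ∑ i ∈ u k, w i := Finset.sum_sigma t u fun x => w x.2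

open scoped symmDiff in
lemma abs_sum_sub_sum_le_sum_symmDiff {ι : Type*} [DecidableEq ι] (s t : Finset ι) (f : ι → ℝ) :
    |∑ i ∈ s, f i - ∑ i ∈ t, f i| ≤ ∑ i ∈ s ∆ t, |f i| := by
  rw [← Finset.sum_sdiff_sub_sum_sdiff, Finset.symmDiff_def,
    Finset.sum_union disjoint_sdiff_sdiff]
  exact (abs_sub _ _).trans (add_le_add (Finset.abs_sum_le_sum_abs _ _)
    (Finset.abs_sum_le_sum_abs _ _))

lemma sum_le_pow_mul_sum_of_walk {V : Type*} {G : SimpleGraph V} {O : Set V} {w : V → ℝ} {c : ℝ}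
    (hc : 0 ≤ c) (hO : ∀ u ∈ O, ∀ v, G.Adj u v → v ∈ O) (hw : ∀ u ∈ O, 0 ≤ w u)
    (hsum : ∀ u ∈ O, ∀ F : Finset V, (∀ v ∈ F, G.Adj u v) → ∑ v ∈ F, w v ≤ c * w u)
    {A B : Finset V} (hA : ↑A ⊆ O) (hB : ↑B ⊆ O) (N : ℕ)
    (hAB : ∀ a ∈ A, ∃ b ∈ B, ∃ p : G.Walk a b, p.length ≤ N) :
    ∑ a ∈ A, w a ≤ (1 + c) ^ N * ∑ b ∈ B, w b := by
  classical
  induction N generalizing A with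
  | zero =>
    rw [pow_zero, one_mul]
    refine Finset.sum_le_sum_of_subset_of_nonneg (fun a ha => ?_) fun b hb _ => hw b (hB hb)
    obtain ⟨b, hb, p, hp⟩ := hAB a ha
    rwa [SimpleGraph.Walk.eq_of_length_eq_zero (Nat.le_zero.1 hp)]
  | succ N ih =>
    have exists_next (a) (ha : a ∈ A) : ∃ v, (a = v ∨ G.Adj a v) ∧
        ∃ b ∈ B, ∃ p : G.Walk v b, p.length ≤ N := by
      obtain ⟨b, hb, p, hp⟩ := hAB a ha
      cases p with
      | nil => exact ⟨a, .inl rfl, a, hb, .nil, N.zero_le⟩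
      | cons h q => exact ⟨_, .inr h, b, hb, q, Nat.le_of_succ_le_succ hp⟩
    choose! next hadj hnext using exists_next
    have hnextO : ↑(A.image next) ⊆ O := by
      rw [Finset.coe_image, Set.image_subset_iff]
      intro a ha
      rcases hadj a ha with h | h
      · exact Set.mem_preimage.2 (h ▸ hA ha)
      · exact hO a (hA ha) _ h
    calc ∑ a ∈ A, w a
        ≤ ∑ v ∈ A.image next, ∑ a ∈ insert v {a ∈ A | G.Adj v a}, w a := by
          refine sum_le_sum_sum_of_cover
            (fun a ha => ⟨next a, Finset.mem_image_of_mem next ha, ?_⟩) fun v hv a ha => hw a ?_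
          · exact Finset.mem_insert.2 ((hadj a ha).imp_right fun h =>
              Finset.mem_filter.2 ⟨ha, h.symm⟩)
          · exact (Finset.mem_insert.1 ha).elim (fun h => h ▸ hnextO hv)
              fun h => hA (Finset.mem_filter.1 h).1
      _ ≤ ∑ v ∈ A.image next, (1 + c) * w v := by
          refine Finset.sum_le_sum fun v hv => ?_
          rw [Finset.sum_insert (by simp), one_add_mul]
          gcongr
          exact hsum v (hnextO hv) _ fun a ha => (Finset.mem_filter.1 ha).2
      _ ≤ (1 + c) * ((1 + c) ^ N * ∑ b ∈ B, w b) := by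
          rw [← Finset.mul_sum]
          gcongr
          exact ih hnextO (Finset.forall_mem_image.2 hnext)
      _ = (1 + c) ^ (N + 1) * ∑ b ∈ B, w b := by ring

lemma weight_inter_le {T : Type*} {δ : T → T → ℝ} {y : T} {A : Finset T} {B : Set T} {f : T → ℝ}
    (hA : ∀ z ∈ A, 0 ≤ δ z y) (hf : ∀ z, 0 ≤ f z) (hfB : ∀ z ∈ B, f z = 1) :
    weight δ y (A ∩ B) ≤ ∑ z ∈ A, f z * δ z y := by
  classical
  calc weight δ y (A ∩ B) = ∑ z ∈ A with z ∈ B, f z * δ z y := by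
        rw [weight, ← Set.sep_mem_eq, ← finsum_mem_coe_finset, Finset.coe_filter]
        exact finsum_mem_congr rfl fun z hz => by rw [hfB z hz.2, one_mul]
    _ ≤ ∑ z ∈ A, f z * δ z y :=
        Finset.sum_le_sum_of_subset_of_nonneg (Finset.filter_subset _ A)
          fun z hz _ => mul_nonneg (hf z) (hA z hz)

variable {T : Type*} [TopologicalSpace T] {Γ : StructureGroupoid T}
  {S : Set (OpenPartialHomeomorph T T)} {γ : OpenPartialHomeomorph T T} {y : T} {δ : T → T → ℝ}
  {A : Finset T}

lemma weight_pos (hδ : IsCocycle Γ δ) (hA : ∀ z ∈ A, (y, z) ∈ orbitRel Γ) (hne : A.Nonempty) :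
    0 < weight δ y A := by
  rw [weight, finsum_mem_coe_finset]
  exact Finset.sum_pos (fun z hz => hδ.1 _ _ (orbitRel_symm (hA z hz))) hne

lemma finite_differenceSet_inter_source (γ : OpenPartialHomeomorph T T) (A : Finset T) :
    (differenceSet γ (A : Set T) ∩ γ.source).Finite := by
  refine (A.finite_toSet.union (A.finite_toSet.image γ.symm)).subset ?_
  rintro x ⟨⟨hxA, -⟩ | ⟨-, -, hγxA⟩, hx⟩
  · exact .inl hxA
  · exact .inr ⟨γ x, hγxA, γ.left_inv hx⟩

lemma orbitRel_of_mem_differenceSet (hγ : γ ∈ Γ) (hA : ∀ z ∈ A, (y, z) ∈ orbitRel Γ) {x : T}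
    (hx : x ∈ differenceSet γ (A : Set T) ∩ γ.source) : (y, x) ∈ orbitRel Γ := by
  obtain ⟨⟨hxA, -⟩ | ⟨-, -, hγxA⟩, hx⟩ := hx
  · exact hA x hxA
  · exact (orbitRel_apply_iff hγ hx).1 (hA _ hγxA)

/-- The points of `A` in `T₁` together with the difference sets of `A` along the generators:
every path in the orbit graph from `A` to `T₁` passes through this set. -/
def exitSet (S : Set (OpenPartialHomeomorph T T)) (T₁ A : Set T) : Set T :=
  A ∩ T₁ ∪ ⋃ γ ∈ S, differenceSet γ A ∩ γ.source

lemma exists_walk_exitSet {A T₁ : Set T} {z t : T} (p : (orbitGraph S).Walk z t) (hz : z ∈ A)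
    (ht : t ∈ T₁) :
    ∃ b ∈ exitSet S T₁ A, ∃ q : (orbitGraph S).Walk z b, q.length ≤ p.length := by
  classical
  by_cases htA : t ∈ A
  · exact ⟨t, .inl ⟨htA, ht⟩, p, le_rfl⟩
  obtain ⟨d, hd, hfst, hsnd⟩ := p.exists_boundary_dart A hz htA
  obtain ⟨-, ⟨γ, hγ, hs, h⟩ | ⟨γ, hγ, hs, h⟩⟩ := (SimpleGraph.fromRel_adj _ _ _).1 d.adj
  · exact ⟨d.fst, .inr (Set.mem_biUnion hγ ⟨.inl ⟨hfst, fun h' => hsnd (h ▸ h'.2)⟩, hs⟩), _,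
      p.length_takeUntil_le_length (p.dart_fst_mem_support_of_mem_darts hd)⟩
  · exact ⟨d.snd, .inr (Set.mem_biUnion hγ ⟨.inr ⟨hsnd, hs, h ▸ hfst⟩, hs⟩), _,
      p.length_takeUntil_le_length (p.dart_snd_mem_support_of_mem_darts hd)⟩

lemma finite_exitSet (hSfin : S.Finite) (T₁ : Set T) (A : Finset T) :
    (exitSet S T₁ (A : Set T)).Finite :=
  (A.finite_toSet.inter_of_left T₁).union
    (hSfin.biUnion fun γ _ => finite_differenceSet_inter_source γ A)

lemma orbitRel_of_mem_exitSet (hS : ∀ γ ∈ S, γ ∈ Γ) (hA : ∀ z ∈ A, (y, z) ∈ orbitRel Γ)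
    {T₁ : Set T} {z : T} (hz : z ∈ exitSet S T₁ (A : Set T)) : (y, z) ∈ orbitRel Γ := by
  rcases hz with hz | hz
  · exact hA z hz.1
  · obtain ⟨γ, hγ, hz⟩ := Set.mem_iUnion₂.1 hz
    exact orbitRel_of_mem_differenceSet (hS γ hγ) hA hz

lemma weight_exitSet_le (hδ : IsCocycle Γ δ) (hS : ∀ γ ∈ S, γ ∈ Γ) (hSfin : S.Finite)
    (hA : ∀ z ∈ A, (y, z) ∈ orbitRel Γ) (T₁ : Set T) :
    weight δ y (exitSet S T₁ (A : Set T)) ≤ weight δ y (A ∩ T₁) +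
      ∑ γ ∈ hSfin.toFinset, weight δ y (differenceSet γ (A : Set T) ∩ γ.source) := by
  classical
  have hfin (γ) := finite_differenceSet_inter_source γ A
  have hT₁ := A.finite_toSet.inter_of_left T₁
  let piece (k : Option (OpenPartialHomeomorph T T)) : Finset T :=
    k.elim hT₁.toFinset fun γ => (hfin γ).toFinset
  have cover : ∀ z ∈ (finite_exitSet hSfin T₁ A).toFinset,
      ∃ k ∈ Finset.insertNone hSfin.toFinset, z ∈ piece k := by
    intro z hz
    rcases (Set.Finite.mem_toFinset _).1 hz with hz | hz
    · exact ⟨none, Finset.none_mem_insertNone, hT₁.mem_toFinset.2 hz⟩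
    · obtain ⟨γ, hγ, hz⟩ := Set.mem_iUnion₂.1 hz
      exact ⟨some γ, Finset.some_mem_insertNone.2 (hSfin.mem_toFinset.2 hγ),
        (hfin γ).mem_toFinset.2 hz⟩
  have subset : ∀ k ∈ Finset.insertNone hSfin.toFinset, ∀ z ∈ piece k, z ∈ exitSet S T₁ ↑A :=
    Finset.forall_mem_insertNone.2 ⟨fun z hz => .inl (hT₁.mem_toFinset.1 hz),
      fun γ hγ z hz => .inr (Set.mem_biUnion (hSfin.mem_toFinset.1 hγ)
        ((hfin γ).mem_toFinset.1 hz))⟩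
  simp only [weight, finsum_mem_eq_finite_toFinset_sum _ (finite_exitSet hSfin T₁ A),
    finsum_mem_eq_finite_toFinset_sum _ hT₁,
    fun γ => finsum_mem_eq_finite_toFinset_sum (δ · y) (hfin γ)]
  exact (sum_le_sum_sum_of_cover cover fun k hk z hz => (hδ.1 _ _ (orbitRel_symm
    (orbitRel_of_mem_exitSet hS hA (subset k hk z hz)))).le).trans_eq (Finset.sum_insertNone _ _)

lemma IsHarmonicCocycle.sum_le_mul (hδharm : IsHarmonicCocycle Γ S δ) (hδ : IsCocycle Γ δ)
    (hS : ∀ γ ∈ S, γ ∈ Γ) {z : T} (hyz : (y, z) ∈ orbitRel Γ) {F : Finset T}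
    (hF : ∀ w ∈ F, (orbitGraph S).Adj z w) : ∑ w ∈ F, δ w y ≤ deg S z * δ z y := by
  have hfin := hδharm.finite_neighborSet hδ z
  rw [← hδharm.finsum_eq hδ hyz, finsum_mem_eq_finite_toFinset_sum _ hfin]
  refine Finset.sum_le_sum_of_subset_of_nonneg (fun w hw => hfin.mem_toFinset.2 (hF w hw))
    fun w hw _ => (hδ.1 _ _ (orbitRel_symm (orbitRel_trans hyz ?_))).le
  exact orbitRel_of_adj hS (hfin.mem_toFinset.1 hw)

lemma IsHarmonicCocycle.weight_le_exitSet (hδharm : IsHarmonicCocycle Γ S δ) (hδ : IsCocycle Γ δ)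
    (hS : ∀ γ ∈ S, γ ∈ Γ) (hSfin : S.Finite) {m N : ℕ} (hm : ∀ z, deg S z ≤ m) {T₁ : Set T}
    (hN : ∀ z, ∃ t ∈ T₁, ∃ p : (orbitGraph S).Walk z t, p.length ≤ N)
    (hA : ∀ z ∈ A, (y, z) ∈ orbitRel Γ) :
    weight δ y A ≤ (1 + m) ^ N * weight δ y (exitSet S T₁ (A : Set T)) := by
  have pos (z) (hz : (y, z) ∈ orbitRel Γ) : 0 ≤ δ z y := (hδ.1 _ _ (orbitRel_symm hz)).le
  have hfin := finite_exitSet hSfin T₁ A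
  rw [weight, weight, finsum_mem_coe_finset, finsum_mem_eq_finite_toFinset_sum _ hfin]
  refine sum_le_pow_mul_sum_of_walk (G := orbitGraph S) (O := {z | (y, z) ∈ orbitRel Γ})
    m.cast_nonneg (fun u hu v huv => orbitRel_trans hu (orbitRel_of_adj hS huv)) pos
    (fun u hu F hF => (hδharm.sum_le_mul hδ hS hu hF).trans
      (mul_le_mul_of_nonneg_right (Nat.cast_le.2 (hm u)) (pos u hu))) hA
    (fun z hz => orbitRel_of_mem_exitSet hS hA (hfin.mem_toFinset.1 hz)) N fun a ha => ?_
  obtain ⟨t, ht, p, hp⟩ := hN a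
  obtain ⟨b, hb, q, hq⟩ := exists_walk_exitSet p ha ht
  exact ⟨b, hfin.mem_toFinset.2 hb, q, hq.trans hp⟩

open Classical in
lemma IsCocycle.sum_indicator_target (hδ : IsCocycle Γ δ) (hγ : γ ∈ Γ)
    (hA : ∀ z ∈ A, (y, z) ∈ orbitRel Γ) (g : T → ℝ) :
    ∑ z ∈ A, γ.target.indicator (fun z => g (γ.symm z)) z * δ z y =
      ∑ x ∈ ({z ∈ A | z ∈ γ.target} : Finset T).image γ.symm, g x * δ (γ x) x * δ x y := by
  have injOn : Set.InjOn γ.symm ({z ∈ A | z ∈ γ.target} : Finset T) :=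
    γ.symm.injOn.mono fun z hz => (Finset.mem_filter.1 hz).2
  rw [Finset.sum_image injOn, Finset.sum_filter]
  refine Finset.sum_congr rfl fun z hzA => ?_
  split_ifs with hz
  · have hzy : (γ.symm z, y) ∈ orbitRel Γ := orbitRel_symm
      ((orbitRel_apply_iff (Γ.symm hγ) hz).2 (hA z hzA))
    rw [Set.indicator_of_mem hz, mul_assoc, hδ.apply_mul hγ (γ.map_target hz) hzy,
      γ.right_inv hz]
  · rw [Set.indicator_of_notMem hz, zero_mul]

lemma abs_sum_sub_sum_le (hδ : IsCocycle Γ δ) (hγ : γ ∈ Γ) (hA : ∀ z ∈ A, (y, z) ∈ orbitRel Γ)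
    {g : T → ℝ} (hg : ∀ x ∉ γ.source, g x = 0) {M : ℝ} (hM : ∀ x, |g x * δ (γ x) x| ≤ M) :
    |∑ z ∈ A, γ.target.indicator (fun z => g (γ.symm z)) z * δ z y -
        ∑ x ∈ A, g x * δ (γ x) x * δ x y| ≤
      M * weight δ y (differenceSet γ (A : Set T) ∩ γ.source) := by
  classical
  have hD := finite_differenceSet_inter_source γ A
  let X : Finset T := ({z ∈ A | z ∈ γ.target} : Finset T).image γ.symm
  let Y : Finset T := {x ∈ A | x ∈ γ.source}
  have mem_X (x) : x ∈ X ↔ x ∈ γ.source ∧ γ x ∈ A := by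
    simp only [X, Finset.mem_image, Finset.mem_filter]
    constructor
    · rintro ⟨z, ⟨hzA, hz⟩, rfl⟩
      exact ⟨γ.map_target hz, by rwa [γ.right_inv hz]⟩
    · rintro ⟨hx, hγx⟩
      exact ⟨γ x, ⟨hγx, γ.map_source hx⟩, γ.left_inv hx⟩
  have symmDiff_eq : symmDiff X Y = hD.toFinset := by
    ext x
    simp only [Finset.mem_symmDiff, mem_X, Y, Finset.mem_filter, Set.Finite.mem_toFinset,
      differenceSet, Set.mem_inter_iff, Set.mem_union, Set.mem_ofPred_eq, Finset.mem_coe]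
    tauto
  have sum_Y : ∑ x ∈ Y, g x * δ (γ x) x * δ x y = ∑ x ∈ A, g x * δ (γ x) x * δ x y :=
    Finset.sum_filter_of_ne fun x _ => not_imp_comm.1 fun hx => by
      rw [hg x hx, zero_mul, zero_mul]
  calc _ ≤ ∑ x ∈ hD.toFinset, |g x * δ (γ x) x * δ x y| := by
        rw [hδ.sum_indicator_target hγ hA, ← sum_Y, ← symmDiff_eq]
        exact abs_sum_sub_sum_le_sum_symmDiff X Y _
    _ ≤ ∑ x ∈ hD.toFinset, M * δ x y := by
        refine Finset.sum_le_sum fun x hx => ?_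
        have pos : 0 < δ x y := hδ.1 _ _ (orbitRel_symm
          (orbitRel_of_mem_differenceSet hγ hA (hD.mem_toFinset.1 hx)))
        rw [abs_mul, abs_of_pos pos]
        exact mul_le_mul_of_nonneg_right (hM x) pos.le
    _ = _ := by
        rw [← Finset.mul_sum, weight, finsum_mem_eq_finite_toFinset_sum _ hD]

end Weight

section VagueLimit

variable {T : Type*}

/-- The probability measure `B ↦ |B ∩ A|_y / |A|_y`. -/
noncomputable def averagingMeasure [MeasurableSpace T] (δ : T → T → ℝ) (y : T) (A : Finset T) :
    Measure T :=
  ∑ z ∈ A, ENNReal.ofReal (δ z y / weight δ y A) • Measure.dirac z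

lemma isProbabilityMeasure_averagingMeasure [MeasurableSpace T] {δ : T → T → ℝ} {y : T}
    {A : Finset T} (hδ : ∀ z ∈ A, 0 ≤ δ z y) (hA : 0 < weight δ y A) :
    IsProbabilityMeasure (averagingMeasure δ y A) where
  measure_univ := by
    have sum_eq : ∑ z ∈ A, δ z y = weight δ y A := (finsum_mem_coe_finset _ _).symm
    simp only [averagingMeasure, Measure.coe_finsetSum, Finset.sum_apply, Measure.smul_apply,
      measure_univ, smul_eq_mul, mul_one]
    rw [← ENNReal.ofReal_sum_of_nonneg fun z hz => div_nonneg (hδ z hz) hA.le, ← Finset.sum_div,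
      sum_eq, div_self hA.ne', ENNReal.ofReal_one]

lemma integral_averagingMeasure [MeasurableSpace T] [MeasurableSingletonClass T]
    {δ : T → T → ℝ} {y : T} {A : Finset T} (hδ : ∀ z ∈ A, 0 ≤ δ z y) (hA : 0 < weight δ y A)
    (f : T → ℝ) :
    ∫ x, f x ∂averagingMeasure δ y A = (∑ z ∈ A, f z * δ z y) / weight δ y A := by
  rw [averagingMeasure, integral_finsetSum_measure fun z _ =>
    (integrable_dirac (by simp)).smul_measure ENNReal.ofReal_ne_top, Finset.sum_div]
  refine Finset.sum_congr rfl fun z hz => ?_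
  rw [integral_smul_measure, integral_dirac, ENNReal.toReal_ofReal (div_nonneg (hδ z hz) hA.le),
    smul_eq_mul, mul_comm, mul_div_assoc]

lemma continuous_and_hasCompactSupport_indicator_symm {X Y : Type*} [TopologicalSpace X]
    [TopologicalSpace Y] [T2Space Y] (γ : OpenPartialHomeomorph X Y) {g : X → ℝ}
    (hg : Continuous g) (hgc : HasCompactSupport g) (hgs : tsupport g ⊆ γ.source) :
    Continuous (γ.target.indicator fun z => g (γ.symm z)) ∧
      HasCompactSupport (γ.target.indicator fun z => g (γ.symm z)) := by
  have isCompact_image : IsCompact (γ '' tsupport g) :=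
    hgc.isCompact.image_of_continuousOn (γ.continuousOn.mono hgs)
  have support_subset :
      Function.support (γ.target.indicator fun z => g (γ.symm z)) ⊆ γ '' tsupport g := by
    rw [Set.support_indicator]
    exact fun z hz => ⟨γ.symm z, subset_tsupport g hz.2, γ.right_inv hz.1⟩
  refine ⟨ContinuousOn.continuous_of_tsupport_subset
    ((hg.comp_continuousOn γ.symm.continuousOn).congr fun z hz => Set.indicator_of_mem hz _)
    γ.open_target ?_, HasCompactSupport.of_support_subset_isCompact isCompact_image
      support_subset⟩
  exact (closure_minimal support_subset isCompact_image.isClosed).trans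
    (Set.image_subset_iff.2 fun x hx => γ.map_source (hgs hx))

variable [TopologicalSpace T] [T2Space T] [MeasurableSpace T] {Γ : StructureGroupoid T}
  {S : Set (OpenPartialHomeomorph T T)} {δ : T → T → ℝ} {y : ℕ → T} {A : ℕ → Finset T}
  {φ : ℕ → ℕ} {ν : Measure T}

lemma IsVagueLimit.integral_indicator_symm_eq (h : IsVagueLimit δ y A φ ν) (hφ : StrictMono φ)
    (hA : IsAveragingSequence Γ S δ y A) (hδ : IsCocycle Γ δ) (hδcont : IsContinuousAlong Γ δ)
    {γ : OpenPartialHomeomorph T T} (hγ : γ ∈ Γ) (hγS : γ ∈ S) {g : T → ℝ} (hg : Continuous g)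
    (hgc : HasCompactSupport g) (hgs : tsupport g ⊆ γ.source) :
    ∫ z, γ.target.indicator (fun z => g (γ.symm z)) z ∂ν = ∫ x, g x * δ (γ x) x ∂ν := by
  have g_eq_zero : ∀ x ∉ γ.source, g x = 0 := fun x hx =>
    image_eq_zero_of_notMem_tsupport fun h => hx (hgs h)
  have hgδ : Continuous fun x => g x * δ (γ x) x :=
    (hg.continuousOn.mul (hδcont γ hγ)).continuous_of_tsupport_subset γ.open_source
      ((tsupport_mul_subset_left).trans hgs)
  have hgδc : HasCompactSupport fun x => g x * δ (γ x) x := hgc.mul_right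
  obtain ⟨M, hM⟩ := hgδ.bounded_above_of_compact_support hgδc
  obtain ⟨hf, hfc⟩ := continuous_and_hasCompactSupport_indicator_symm γ hg hgc hgs
  have tendsto_bound := ((hA.tendsto γ hγS).comp hφ.tendsto_atTop).const_mul M
  rw [mul_zero] at tendsto_bound
  refine sub_eq_zero.1 (tendsto_nhds_unique ((h _ hf hfc).sub (h _ hgδ hgδc))
    (squeeze_zero_norm (fun k => ?_) tendsto_bound))
  have pos := weight_pos hδ (hA.subset_orbit (φ k)) (hA.nonempty (φ k))
  rw [← sub_div, norm_div, Real.norm_eq_abs, Real.norm_eq_abs, abs_of_pos pos,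
    Function.comp_apply, ← mul_div_assoc]
  exact div_le_div_of_nonneg_right
    (abs_sum_sub_sum_le hδ hγ (hA.subset_orbit (φ k)) g_eq_zero hM) pos.le

variable [LocallyCompactSpace T]

lemma IsVagueLimit.ne_zero (h : IsVagueLimit δ y A φ ν) (hφ : StrictMono φ)
    (hA : IsAveragingSequence Γ S δ y A) (hδ : IsCocycle Γ δ) (hδharm : IsHarmonicCocycle Γ S δ)
    (hS : ∀ γ ∈ S, γ ∈ Γ) (hSfin : S.Finite) {T₁ : Set T} (hT₁ : IsCompact (closure T₁))
    (hrec : IsRecurrent S T₁) : ν ≠ 0 := by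
  rintro rfl
  obtain ⟨m, hm⟩ := exists_deg_le hSfin
  obtain ⟨N, hN⟩ := hrec
  obtain ⟨f, hf_one, -, hfc, hf⟩ := exists_continuous_one_zero_of_isCompact hT₁
    isClosed_empty (Set.disjoint_empty _)
  have tendsto_sum := h f f.continuous hfc
  rw [integral_zero_measure] at tendsto_sum
  have tendsto_diff : Tendsto (fun k => ∑ γ ∈ hSfin.toFinset,
      weight δ (y (φ k)) (differenceSet γ (A (φ k)) ∩ γ.source) /
        weight δ (y (φ k)) (A (φ k))) atTop (𝓝 0) := by
    simpa only [Finset.sum_const_zero, Function.comp_def] using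
      tendsto_finsetSum hSfin.toFinset fun γ hγ =>
        (hA.tendsto γ (hSfin.mem_toFinset.1 hγ)).comp hφ.tendsto_atTop
  have one_le : (1 : ℝ) ≤ (1 + m) ^ N * (0 + 0) := by
    refine ge_of_tendsto' ((tendsto_sum.add tendsto_diff).const_mul _) fun k => ?_
    have hAk := hA.subset_orbit (φ k)
    rw [← Finset.sum_div, ← add_div, ← mul_div_assoc,
      one_le_div (weight_pos hδ hAk (hA.nonempty (φ k)))]
    refine (hδharm.weight_le_exitSet hδ hS hSfin hm hN hAk).trans ?_
    gcongr
    refine (weight_exitSet_le hδ hS hSfin hAk T₁).trans ?_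
    gcongr
    exact weight_inter_le (fun z hz => (hδ.1 _ _ (orbitRel_symm (hAk z hz))).le)
      (fun z => (hf z).1) fun z hz => hf_one (subset_closure hz)
  norm_num at one_le

variable [BorelSpace T]

lemma IsAveragingSequence.exists_isVagueLimit [SecondCountableTopology T]
    (hA : IsAveragingSequence Γ S δ y A) (hδ : IsCocycle Γ δ) :
    ∃ (φ : ℕ → ℕ) (ν : Measure T), StrictMono φ ∧ IsFiniteMeasure ν ∧
      IsVagueLimit δ y A φ ν := by
  have nonneg (n) : ∀ z ∈ A n, 0 ≤ δ z (y n) := fun z hz =>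
    (hδ.1 _ _ (orbitRel_symm (hA.subset_orbit n z hz))).le
  have pos (n) := weight_pos hδ (hA.subset_orbit n) (hA.nonempty n)
  obtain ⟨φ, ν, hφ, hν, h⟩ := exists_subseq_tendsto_vague
    (fun n => averagingMeasure δ (y n) (A n))
    fun n => isProbabilityMeasure_averagingMeasure (nonneg n) (pos n)
  refine ⟨φ, ν, hφ, hν, fun f hf hfc => ?_⟩
  simpa only [integral_averagingMeasure (nonneg _) (pos _)] using h f hf hfc

lemma IsVagueLimit.hasDensityAlong [SecondCountableTopology T] [IsFiniteMeasure ν]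
    (h : IsVagueLimit δ y A φ ν) (hφ : StrictMono φ) (hA : IsAveragingSequence Γ S δ y A)
    (hδ : IsCocycle Γ δ) (hδcont : IsContinuousAlong Γ δ) {γ : OpenPartialHomeomorph T T}
    (hγ : γ ∈ Γ) (hγS : γ ∈ S) : HasDensityAlong δ ν γ := by
  have hγδ := hδcont γ hγ
  have hms := γ.open_source.measurableSet
  have hmt := γ.open_target.measurableSet
  refine hasDensityAlong_iff_restrict_eq.2 (restrict_eq_of_forall_integral_eq γ.open_source
    (fun K _ _ => measure_lt_top _ K) (fun K hKs hK => ?_) fun g hg hgc hgs => ?_)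
  · rw [withDensity_apply' _ K]
    exact ((hγδ.mono hKs).integrableOn_compact hK).lintegral_lt_top
  have g_eq_zero : ∀ x ∉ γ.source, g x = 0 := fun x hx =>
    image_eq_zero_of_notMem_tsupport fun h => hx (hgs h)
  calc ∫ x, g x ∂(ν.restrict γ.target).map γ.symm
      = ∫ z, γ.target.indicator (fun z => g (γ.symm z)) z ∂ν := by
        rw [integral_map (aemeasurable_restrict γ.symm hmt subset_rfl)
          hg.aestronglyMeasurable, integral_indicator hmt]
    _ = ∫ x, g x * δ (γ x) x ∂ν :=
        h.integral_indicator_symm_eq hφ hA hδ hδcont hγ hγS hg hgc hgs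
    _ = ∫ x in γ.source, g x * δ (γ x) x ∂ν :=
        (setIntegral_eq_integral_of_forall_compl_eq_zero fun x hx => by
          rw [g_eq_zero x hx, zero_mul]).symm
    _ = ∫ x in γ.source, (ENNReal.ofReal (δ (γ x) x)).toReal • g x ∂ν :=
        setIntegral_congr_fun hms fun x hx => by
          rw [ENNReal.toReal_ofReal (hδ.apply_pos hγ hx).le, smul_eq_mul, mul_comm]
    _ = ∫ x in γ.source, g x ∂ν.withDensity fun y => ENNReal.ofReal (δ (γ y) y) := by
        rw [restrict_withDensity hms, integral_withDensity_eq_integral_toReal_smul₀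
          (hγδ.aemeasurable hms).ennreal_ofReal (by simp)]
    _ = ∫ x, g x ∂ν.withDensity fun y => ENNReal.ofReal (δ (γ y) y) :=
        setIntegral_eq_integral_of_forall_compl_eq_zero g_eq_zero

lemma IsVagueLimit.mem_limitSet [FirstCountableTopology T] [IsFiniteMeasureOnCompacts ν]
    (h : IsVagueLimit δ y A φ ν) (hφ : StrictMono φ) {x : T} (hx : x ∈ ν.support) :
    x ∈ limitSet A := by
  have frequently_mem (U) (hU : U ∈ 𝓝 x) : ∃ᶠ k in atTop, ∃ u ∈ A (φ k), u ∈ U := by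
    obtain ⟨f, hf_one, hf_zero, hfc, hf⟩ := exists_continuous_one_zero_of_isCompact
      isCompact_singleton isOpen_interior.isClosed_compl
      (Set.disjoint_compl_right_iff_subset.2 (Set.singleton_subset_iff.2
        (mem_interior_iff_mem_nhds.2 hU)))
    have support_mem : Function.support f ∈ 𝓝 x := f.continuous.isOpen_support.mem_nhds
      (by rw [Function.mem_support, hf_one rfl]; exact one_ne_zero)
    have integral_pos : 0 < ∫ z, f z ∂ν := (integral_pos_iff_support_of_nonneg
      (fun z => (hf z).1) (f.continuous.integrable_of_hasCompactSupport hfc)).2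
      ((Measure.mem_support_iff_forall x).1 hx _ support_mem)
    refine (((h f f.continuous hfc).eventually_const_lt integral_pos).mono
      fun k hk => ?_).frequently
    by_contra! hne
    refine hk.ne' ?_
    rw [Finset.sum_eq_zero fun z hz => ?_, zero_div]
    rw [hf_zero fun hzU => hne z hz (interior_subset hzU), Pi.zero_apply, zero_mul]
  obtain ⟨U, hU⟩ := (𝓝 x).exists_antitone_basis
  obtain ⟨ψ, hψ, hmem⟩ := extraction_forall_of_frequently fun n => frequently_mem (U n) (hU.mem n)
  choose u huA huU using hmem
  exact ⟨φ ∘ ψ, u, hφ.comp hψ, huA, hU.tendsto huU⟩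

end VagueLimit

theorem corollary3p3_general {T : Type*} [TopologicalSpace T] [T2Space T]
    [SecondCountableTopology T] [LocallyCompactSpace T] [MeasurableSpace T] [BorelSpace T]
    (Γ : StructureGroupoid T) [ClosedUnderRestriction Γ]
    (T₁ : Set T) (hT₁ : IsCompact (closure T₁))
    (S : Set (OpenPartialHomeomorph T T)) (hSfin : S.Finite)
    (hSgen : Generates Γ S) (hSrec : IsRecurrent S T₁)
    (δ : T → T → ℝ) (hδ : IsCocycle Γ δ) (hδcont : IsContinuousAlong Γ δ)
    (hδharm : IsHarmonicCocycle Γ S δ)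
    (y : ℕ → T) (A : ℕ → Finset T) (hA : IsAveragingSequence Γ S δ y A) :
    ∃ ν : Measure T, ν ≠ 0 ∧ IsFiniteMeasure ν ∧ ν.Regular ∧
      IsHarmonicMeasure Γ S ν ∧
      ν.support ⊆ limitSet A ∧
      ∃ (φ : ℕ → ℕ) (ν₀ : Measure T), StrictMono φ ∧ IsFiniteMeasure ν₀ ∧
        IsVagueLimit δ y A φ ν₀ ∧
        HasRadonNikodymCocycle Γ δ ν₀ ∧
        ν = ν₀.withDensity fun x => (deg S x : ENNReal) := by
  have hS := hSgen.1
  obtain ⟨φ, ν₀, hφ, hfin, hlim⟩ := hA.exists_isVagueLimit hδ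
  have hRN : HasRadonNikodymCocycle Γ δ ν₀ := hasRadonNikodymCocycle_of_generates hSgen hδ hδcont
    fun γ hγ => hlim.hasDensityAlong hφ hA hδ hδcont (hS γ hγ) hγ
  have hne : ν₀ ≠ 0 := hlim.ne_zero hφ hA hδ hδharm hS hSfin hT₁ hSrec
  have hfin_deg := isFiniteMeasure_withDensity_deg (ν := ν₀) hSfin
  refine ⟨ν₀.withDensity fun x => (deg S x : ENNReal), ?_, hfin_deg, inferInstance,
    isHarmonicMeasure_withDensity_deg hS hSfin hδ hδcont hδharm hRN, fun x hx => ?_,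
    φ, ν₀, hφ, hfin, hlim, hRN, rfl⟩
  · rwa [Ne, ← Measure.measure_univ_eq_zero, withDensity_deg_eq_zero_iff hS hSfin hδ hδharm,
      Measure.measure_univ_eq_zero]
  · exact hlim.mem_limitSet hφ ((withDensity_absolutelyContinuous _ _).support_mono hx)

end Averaging

theorem corollary3p3 {T : Type*} [TopologicalSpace T] [TopologicalSpace.MetrizableSpace T]
    [TopologicalSpace.SeparableSpace T] [LocallyCompactSpace T]
    [MeasurableSpace T] [BorelSpace T]
    (hzero : TopologicalSpace.IsTopologicalBasis {U : Set T | IsClopen U})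
    (Γ : StructureGroupoid T) [ClosedUnderRestriction Γ]
    (hfree : Averaging.ActsFreely Γ)
    (T₁ : Set T) (E : Set (OpenPartialHomeomorph T T))
    (hE : Averaging.IsCompactGenerationSystem Γ T₁ E)
    (S : Set (OpenPartialHomeomorph T T)) (hSfin : S.Finite)
    (hSgen : Averaging.Generates Γ S) (hSrec : Averaging.IsRecurrent S T₁)
    (δ : T → T → ℝ) (hδ : Averaging.IsCocycle Γ δ)
    (hδcont : Averaging.IsContinuousCocycle Γ δ)
    (hδharm : Averaging.IsHarmonicCocycle Γ S δ)
    (y : ℕ → T) (A : ℕ → Finset T)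
    (hA : Averaging.IsAveragingSequence Γ S δ y A) :
    ∃ ν : Measure T, ν ≠ 0 ∧ IsFiniteMeasure ν ∧ ν.Regular ∧
      Averaging.IsHarmonicMeasure Γ S ν ∧
      ν.support ⊆ Averaging.limitSet A ∧
      ∃ (φ : ℕ → ℕ) (ν₀ : Measure T), StrictMono φ ∧ IsFiniteMeasure ν₀ ∧
        Averaging.IsVagueLimit δ y A φ ν₀ ∧
        Averaging.HasRadonNikodymCocycle Γ δ ν₀ ∧
        ν = ν₀.withDensity fun x => (Averaging.deg S x : ENNReal) := by
  let : MetricSpace T := TopologicalSpace.metrizableSpaceMetric T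
  have : SecondCountableTopology T := UniformSpace.secondCountable_of_separable T
  exact Averaging.corollary3p3_general Γ T₁ hE.isCompact_closure S hSfin hSgen hSrec δ hδ
    (hδcont.isContinuousAlong hfree) hδharm y A hA
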